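/- Let $A$ be a ($\mathbb{Z}$-graded, associative, unital) dg algebra over $\mathbb{C}$ which is proper, meaning that its total cohomology $H^*(A)$ is finite-dimensional. Suppose that $A$ carries a rational action of $\mathbb{C}^*$: a linear action by dg algebra automorphisms (preserving degrees, product, unit and differential) such that the underlying representation is rational, that is, a direct sum of finite-dimensional algebraic representations of $\mathbb{C}^*$. Let $D(A)$ be the derived category of right dg modules over $A$ (dg modules with quasi-isomorphisms inverted), and write $H^i(\hom(M,N)) = \mathrm{Hom}_{D(A)}(M,N[i])$. Let $M$ be a right dg module over $A$ which is - perfect: in $D(A)$, $M$ is isomorphic to a direct summand of a dg module built from the free module $A$ by a finite sequence of shifts and mapping cones; - rigid: $H^1(\hom(M,M)) = 0$; - simple: $H^0(\hom(M,M)) \cong \mathbb{C}$. Then $M$ is quasi-isomorphic (connected by a finite zigzag of quasi-isomorphisms of dg modules) to a $\mathbb{C}^*$-equivariant dg module, that is, to a right dg module $N$ over $A$ equipped with a rational linear action of $\mathbb{C}^*$ which preserves degrees, commutes with the differential, and satisfies $z\cdot(na) = (z\cdot n)(z\cdot a)$ for all $z \in \mathbb{C}^*$, $n \in N$, $a \in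 A$. -/

import Mathlib

open CategoryTheory

universe u

/-! ### Differential graded algebras -/

/-- A differential graded algebra over `ℂ` (`ℤ`-graded, associative, unital, with a
differential of degree `+1`).  The carrier is the direct sum of the graded pieces. -/
structure DGAlgebra : Type (u + 1) where
  carrier : Type u
  [ring : Ring carrier]
  [algebra : Algebra ℂ carrier]
  /-- The piece of degree `n`. -/
  deg : ℤ → Submodule ℂ carrier
  [graded : GradedAlgebra deg]
  /-- The differential. -/
  d : carrier →ₗ[ℂ] carrier
  d_mem : ∀ (n : ℤ) (a : carrier), a ∈ deg n → d a ∈ deg (n + 1)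
  d_d : ∀ a : carrier, d (d a) = 0
  leibniz : ∀ (n : ℤ) (a b : carrier), a ∈ deg n →
    d (a * b) = d a * b + n.negOnePow • (a * d b)

attribute [instance] DGAlgebra.ring DGAlgebra.algebra DGAlgebra.graded

/-- The cohomology `ker d / im d` of a linear endomorphism `d`.  For the differential of a
complex, written as one endomorphism of the direct sum of its terms, this is the total
cohomology, the direct sum of the `H^n`. -/
abbrev Cohomology {V : Type u} [AddCommGroup V] [Module ℂ V] (d : V →ₗ[ℂ] V) : Type u :=
  LinearMap.ker d ⧸ (LinearMap.range d).submoduleOf (LinearMap.ker d)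

/-- A dg algebra is proper if its total cohomology is finite-dimensional. -/
def DGAlgebra.IsProper (A : DGAlgebra.{u}) : Prop :=
  FiniteDimensional ℂ (Cohomology A.d)

/-! ### Right dg modules -/

/-- A right dg module over the dg algebra `A`; `act m a` is the product `m · a`. -/
structure DGModule (A : DGAlgebra.{u}) : Type (u + 1) where
  carrier : Type u
  [addCommGroup : AddCommGroup carrier]
  [module : Module ℂ carrier]
  /-- The piece of degree `n`. -/
  deg : ℤ → Submodule ℂ carrier
  [graded : DirectSum.Decomposition deg]
  /-- The differential. -/
  d : carrier →ₗ[ℂ] carrier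
  d_mem : ∀ (n : ℤ) (m : carrier), m ∈ deg n → d m ∈ deg (n + 1)
  d_d : ∀ m : carrier, d (d m) = 0
  /-- The right action of `A`. -/
  act : carrier →ₗ[ℂ] A.carrier →ₗ[ℂ] carrier
  act_mem : ∀ (i j : ℤ) (m : carrier) (a : A.carrier),
    m ∈ deg i → a ∈ A.deg j → act m a ∈ deg (i + j)
  act_one : ∀ m : carrier, act m 1 = m
  act_mul : ∀ (m : carrier) (a b : A.carrier), act m (a * b) = act (act m a) b
  leibniz : ∀ (n : ℤ) (m : carrier) (a : A.carrier), m ∈ deg n →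
    d (act m a) = act (d m) a + n.negOnePow • act m (A.d a)

attribute [instance] DGModule.addCommGroup DGModule.module DGModule.graded

namespace DGModule

variable {A : DGAlgebra.{u}}

/-- A morphism of dg modules: a linear map of degree `0` which commutes with the
differentials and with the action of `A`. -/
@[ext]
structure Hom (M N : DGModule A) : Type u where
  toLin : M.carrier →ₗ[ℂ] N.carrier
  map_mem : ∀ (n : ℤ) (m : M.carrier), m ∈ M.deg n → toLin m ∈ N.deg n
  map_d : ∀ m : M.carrier, toLin (M.d m) = N.d (toLin m)
  map_act : ∀ (m : M.carrier) (a : A.carrier), toLin (M.act m a) = N.act (toLin m) a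

instance : Category (DGModule A) where
  Hom := Hom
  id M :=
    { toLin := LinearMap.id
      map_mem := fun _ _ h => h
      map_d := fun _ => rfl
      map_act := fun _ _ => rfl }
  comp f g :=
    { toLin := g.toLin ∘ₗ f.toLin
      map_mem := fun n m h => g.map_mem n _ (f.map_mem n m h)
      map_d := fun m => by simp [f.map_d, g.map_d]
      map_act := fun m a => by simp [f.map_act, g.map_act] }

/-- The endomorphism `m ↦ c m` of a dg module, for a scalar `c`. -/
def scalar (M : DGModule A) (c : ℂ) : M ⟶ M :=
  { toLin := c • LinearMap.id
    map_mem := fun n _ h => (M.deg n).smul_mem c h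
    map_d := fun m => by simp
    map_act := fun m a => by simp : Hom M M }

/-- The map induced on cohomology by a morphism of dg modules. -/
def cohomologyMap {M N : DGModule A} (f : M ⟶ N) :
    Cohomology M.d →ₗ[ℂ] Cohomology N.d :=
  Submodule.mapQ _ _
    (f.toLin.restrict (p := LinearMap.ker M.d) (q := LinearMap.ker N.d) (fun m hm => by
      rw [LinearMap.mem_ker] at hm ⊢
      rw [← f.map_d, hm, map_zero]))
    (by
      rintro ⟨m, hm⟩ ⟨x, hx⟩
      exact ⟨f.toLin x, by rw [← f.map_d, hx]; rfl⟩)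

/-- Quasi-isomorphisms: morphisms of dg modules that induce an isomorphism on cohomology.
(Morphisms preserve degrees, so this holds in total if and only if it holds in each degree.) -/
def quasiIso (A : DGAlgebra.{u}) : MorphismProperty (DGModule A) :=
  fun _ _ f => Function.Bijective (cohomologyMap f)

/-- Two dg modules are quasi-isomorphic if they are connected by a finite zigzag of
quasi-isomorphisms. -/
def QuasiIsomorphic (M N : DGModule A) : Prop :=
  Relation.EqvGen (fun X Y : DGModule A => ∃ f : X ⟶ Y, quasiIso A f) M N

/-! ### The derived category -/

variable (A) in
/-- The derived category of dg modules: dg modules with the quasi-isomorphisms inverted. -/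
abbrev Derived : Type (u + 1) := (quasiIso A).Localization

/-- A dg module as an object of the derived category. -/
abbrev toDerived (M : DGModule A) : Derived A := (quasiIso A).Q.obj M

/-! ### Free module, shifts and mapping cones -/

variable (A) in
/-- `A` as a right dg module over itself. -/
def free : DGModule A where
  carrier := A.carrier
  deg := A.deg
  d := A.d
  d_mem := A.d_mem
  d_d := A.d_d
  act := LinearMap.mul ℂ A.carrier
  act_mem := fun _ _ _ _ hm ha => SetLike.mul_mem_graded hm ha
  act_one := fun m => by simp
  act_mul := fun m a b => by simp [mul_assoc]
  leibniz := fun n m a h => by simpa using A.leibniz n m a h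

theorem lof_congr {V : Type u} [AddCommGroup V] [Module ℂ V] (p : ℤ → Submodule ℂ V)
    {i j : ℤ} (h : i = j) (x : p i) (y : p j) (hxy : (x : V) = y) :
    DirectSum.lof ℂ ℤ (fun k => p k) i x = DirectSum.lof ℂ ℤ (fun k => p k) j y := by
  subst h
  rw [Subtype.ext hxy]

/-- Reindexing a grading by a translation. -/
@[reducible]
noncomputable def shiftDecomposition {V : Type u} [AddCommGroup V] [Module ℂ V]
    (p : ℤ → Submodule ℂ V) [DirectSum.Decomposition p] (n : ℤ) :
    DirectSum.Decomposition (fun k => p (k + n)) :=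
  DirectSum.Decomposition.ofLinearMap _
    (DirectSum.toModule ℂ ℤ _ (fun i =>
      DirectSum.lof ℂ ℤ (fun k => p (k + n)) (i - n) ∘ₗ
        Submodule.inclusion (by rw [sub_add_cancel])) ∘ₗ
      (DirectSum.decomposeLinearEquiv p).toLinearMap)
    (by
      ext v
      induction v using DirectSum.Decomposition.inductionOn p with
      | zero => simp
      | add a b ha hb => simpa using congrArg₂ (· + ·) ha hb
      | homogeneous v =>
        simp [DirectSum.decomposeLinearEquiv_apply, DirectSum.decompose_coe,
          DirectSum.toModule_lof, ← DirectSum.lof_eq_of ℂ])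
    (by
      ext k ⟨v, hv⟩ : 2
      simp only [LinearMap.comp_apply, DirectSum.coeLinearMap_lof, LinearMap.id_apply,
        LinearEquiv.coe_coe, DirectSum.decomposeLinearEquiv_apply,
        DirectSum.decompose_of_mem p hv, ← DirectSum.lof_eq_of ℂ, DirectSum.toModule_lof]
      exact lof_congr (fun k => p (k + n)) (by ring) _ _ rfl)

/-- The grading of a direct sum of two graded vector spaces. -/
@[reducible]
noncomputable def prodDecomposition {V W : Type u} [AddCommGroup V] [Module ℂ V]
    [AddCommGroup W] [Module ℂ W] (p : ℤ → Submodule ℂ V) (q : ℤ → Submodule ℂ W)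
    [DirectSum.Decomposition p] [DirectSum.Decomposition q] :
    DirectSum.Decomposition (fun k => (p k).prod (q k)) :=
  DirectSum.Decomposition.ofLinearMap _
    (LinearMap.coprod
      (DirectSum.toModule ℂ ℤ _ (fun i =>
        DirectSum.lof ℂ ℤ (fun k => (p k).prod (q k)) i ∘ₗ
          (LinearMap.inl ℂ V W).restrict (fun v hv => ⟨hv, (q i).zero_mem⟩)) ∘ₗ
        (DirectSum.decomposeLinearEquiv p).toLinearMap)
      (DirectSum.toModule ℂ ℤ _ (fun i =>
        DirectSum.lof ℂ ℤ (fun k => (p k).prod (q k)) i ∘ₗ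
          (LinearMap.inr ℂ V W).restrict (fun w hw => ⟨(p i).zero_mem, hw⟩)) ∘ₗ
        (DirectSum.decomposeLinearEquiv q).toLinearMap))
    (by
      apply LinearMap.prod_ext
      · ext1 v
        induction v using DirectSum.Decomposition.inductionOn p with
        | zero => simp; rfl
        | add a b ha hb => rw [map_add, map_add, ha, hb]
        | homogeneous v =>
          simp [DirectSum.decomposeLinearEquiv_apply, DirectSum.decompose_coe,
            DirectSum.toModule_lof, ← DirectSum.lof_eq_of ℂ]
          rfl
      · ext1 v
        induction v using DirectSum.Decomposition.inductionOn q with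
        | zero => simp; rfl
        | add a b ha hb => rw [map_add, map_add, ha, hb]
        | homogeneous v =>
          simp [DirectSum.decomposeLinearEquiv_apply, DirectSum.decompose_coe,
            DirectSum.toModule_lof, ← DirectSum.lof_eq_of ℂ]
          rfl)
    (by
      ext k ⟨⟨v, w⟩, hv, hw⟩ : 2
      simp only [LinearMap.comp_apply, DirectSum.coeLinearMap_lof, LinearMap.id_apply,
        LinearMap.coprod_apply,
        LinearEquiv.coe_coe, DirectSum.decomposeLinearEquiv_apply,
        DirectSum.decompose_of_mem p hv, DirectSum.decompose_of_mem q hw,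
        ← DirectSum.lof_eq_of ℂ, DirectSum.toModule_lof, ← map_add]
      exact lof_congr (fun k => (p k).prod (q k)) rfl _ _ (Prod.ext (add_zero v) (zero_add w)))

/-- The shift `M[n]`, with `M[n]^k = M^(k+n)` and differential `(-1)^n d`. -/
noncomputable def shift (M : DGModule A) (n : ℤ) : DGModule A where
  carrier := M.carrier
  deg := fun k => M.deg (k + n)
  graded := shiftDecomposition M.deg n
  d := n.negOnePow • M.d
  d_mem := fun k m h => by
    have := M.d_mem _ m h
    rw [add_right_comm] at this
    exact (M.deg (k + 1 + n)).smul_of_tower_mem n.negOnePow this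
  d_d := fun m => by simp [M.d_d]
  act := M.act
  act_mem := fun i j m a hm ha => by
    have := M.act_mem _ _ m a hm ha
    rwa [add_right_comm] at this
  act_one := M.act_one
  act_mul := M.act_mul
  leibniz := fun k m a h => by
    have := M.leibniz _ m a h
    simp only [LinearMap.smul_apply, this, smul_add, smul_smul, ← mul_assoc,
      Int.negOnePow_add]
    congr 2
    · rcases Int.units_eq_one_or n.negOnePow with h | h <;> simp [h]
    · rw [mul_comm n.negOnePow, mul_assoc, Int.units_mul_self, mul_one]

/-- The mapping cone `M[1] ⊕ N` of `f : M ⟶ N`, with differential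
`(m, n) ↦ (-d m, f m + d n)`. -/
noncomputable def cone {M N : DGModule A} (f : M ⟶ N) : DGModule A where
  carrier := M.carrier × N.carrier
  deg := fun k => (M.deg (k + 1)).prod (N.deg k)
  graded :=
    letI := shiftDecomposition M.deg 1
    prodDecomposition (fun k => M.deg (k + 1)) N.deg
  d := (-(M.d ∘ₗ LinearMap.fst ℂ _ _)).prod
    (f.toLin ∘ₗ LinearMap.fst ℂ _ _ + N.d ∘ₗ LinearMap.snd ℂ _ _)
  d_mem := fun k m h => by
    exact ⟨(M.deg (k + 1 + 1)).neg_mem (M.d_mem _ _ h.1),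
      (N.deg (k + 1)).add_mem (f.map_mem _ _ h.1) (N.d_mem _ _ h.2)⟩
  d_d := fun m => by simp [M.d_d, N.d_d, f.map_d]
  act := LinearMap.mk₂ ℂ (fun x a => (M.act x.1 a, N.act x.2 a))
    (fun x y a => by simp) (fun c x a => by simp) (fun x a b => by simp) (fun c x a => by simp)
  act_mem := fun i j m a hm ha => by
    refine ⟨?_, N.act_mem i j m.2 a hm.2 ha⟩
    have := M.act_mem _ _ m.1 a hm.1 ha
    rwa [add_right_comm] at this
  act_one := fun m => by simp [act_one]
  act_mul := fun m a b => by simp [act_mul]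
  leibniz := fun k m a h => by
    have h1 := M.leibniz _ m.1 a h.1
    have h2 := N.leibniz _ m.2 a h.2
    rw [Int.negOnePow_succ] at h1
    ext
    · simp [h1, add_comm]
    · simp [h2, f.map_act, add_assoc]

/-! ### Perfect, rigid and simple modules -/

/-- The dg modules obtained from the free module `A` by a finite sequence of shifts and
mapping cones. -/
inductive IsFiniteCell : DGModule A → Prop
  | free : IsFiniteCell (free A)
  | shift (M : DGModule A) (n : ℤ) : IsFiniteCell M → IsFiniteCell (M.shift n)
  | cone {M N : DGModule A} (f : M ⟶ N) : IsFiniteCell M → IsFiniteCell N →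
      IsFiniteCell (cone f)

/-- `M` is perfect if, in the derived category, it is a direct summand (equivalently, a
retract) of a module obtained from `A` by finitely many shifts and mapping cones. -/
def IsPerfect (M : DGModule A) : Prop :=
  ∃ P : DGModule A, IsFiniteCell P ∧ Nonempty (Retract M.toDerived P.toDerived)

/-- `H^n(hom(M, N))`: morphisms from `M` to `N[n]` in the derived category. -/
abbrev DerivedHom (n : ℤ) (M N : DGModule A) : Type (u + 1) :=
  M.toDerived ⟶ (N.shift n).toDerived

/-- `M` is rigid if `H^1(hom(M, M)) = 0`: the zero morphism is the only one from `M` to `M[1]`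
in the derived category. -/
def IsRigid (M : DGModule A) : Prop := Subsingleton (DerivedHom 1 M M)

/-- `M` is simple if `H^0(hom(M, M)) = ℂ`: the structure map `c ↦ c · id` from `ℂ` to the
algebra of endomorphisms of `M` in the derived category is bijective (equivalently, that
algebra is one-dimensional). -/
def IsSimple (M : DGModule A) : Prop :=
  Function.Bijective (fun c : ℂ => ((quasiIso A).Q.map (M.scalar c) : End M.toDerived))

end DGModule

/-! ### Rational actions of `ℂ^*` -/

/-- A representation of `ℂ^* = ℂˣ` is rational if each orbit map `z ↦ z · v` is a Laurent
polynomial in `z` with coefficients in `V`, that is, if the representation comes from a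
coaction `V → ℂ[z, z⁻¹] ⊗ V`.  Equivalently, it is a direct sum of finite-dimensional
algebraic representations. -/
def IsRationalRep {V : Type u} [AddCommGroup V] [Module ℂ V] (ρ : Representation ℂ ℂˣ V) : Prop :=
  ∀ v : V, ∃ c : ℤ →₀ V, ∀ z : ℂˣ, ρ z v = c.sum fun k w => ((z ^ k : ℂˣ) : ℂ) • w

/-- A rational action of `ℂ^*` on a dg algebra, by automorphisms of dg algebras. -/
structure DGAlgebra.RationalAction (A : DGAlgebra.{u}) where
  ρ : Representation ℂ ℂˣ A.carrier
  rational : IsRationalRep ρ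
  map_mem : ∀ (z : ℂˣ) (n : ℤ) (a : A.carrier), a ∈ A.deg n → ρ z a ∈ A.deg n
  map_d : ∀ (z : ℂˣ) (a : A.carrier), ρ z (A.d a) = A.d (ρ z a)
  map_one : ∀ z : ℂˣ, ρ z 1 = 1
  map_mul : ∀ (z : ℂˣ) (a b : A.carrier), ρ z (a * b) = ρ z a * ρ z b

/-- The structure of a `ℂ^*`-equivariant dg module on `N`: a rational action of `ℂ^*` on the
underlying graded vector space which is compatible with the differential and with the action
of `A`, on which `ℂ^*` acts through `α`. -/
structure DGModule.EquivariantStructure {A : DGAlgebra.{u}} (α : A.RationalAction)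
    (N : DGModule A) where
  ρ : Representation ℂ ℂˣ N.carrier
  rational : IsRationalRep ρ
  map_mem : ∀ (z : ℂˣ) (n : ℤ) (m : N.carrier), m ∈ N.deg n → ρ z m ∈ N.deg n
  map_d : ∀ (z : ℂˣ) (m : N.carrier), ρ z (N.d m) = N.d (ρ z m)
  map_act : ∀ (z : ℂˣ) (m : N.carrier) (a : A.carrier),
    ρ z (N.act m a) = N.act (ρ z m) (α.ρ z a)

/-!
The action of `ℂ^*` on `A` is generated by the Euler derivation, which is multiplication by `k` on
the elements of weight `k`. Deforming `M` to first order along this derivation gives the Atiyah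
extension of `M` by itself, whose class lies in `H¹(hom(M, M)) = 0`. Hence (`exists_connection`)
there are a quasi-isomorphism `s : X ⟶ M` and a connection: a linear map `δ : X → M` that commutes
with the differentials and satisfies `δ(x a) = δ(x) a + s(x) euler(a)`. To read off `X`, `s` and `δ`
from the vanishing of a morphism in the localization, the quasi-isomorphisms in the homotopy
category are shown to admit a calculus of right fractions.

On cohomology, `s⁻¹ δ` is an endomorphism `E` of `H(X)`, which is finite-dimensional since `M` is
perfect and `A` is proper. An element of `A` of weight `k` maps the generalized eigenspace of `E` for
`l` to the one for `l + k`, so generalized eigenvalues act as weights, with values in `ℂ` instead of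
`ℤ`. This is lifted to the chain level by local cohomology over `ℂ[t]`, where `t` acts as `E`.
For any dg module `Y`, let `torsion Y` be `Y ⊗ ℂ(t)/ℂ[t]`, with elements of weight `k` also
translating `t` by `k`. It splits by the positions `l ∈ ℂ` of the poles, and giving the functions
with their pole at `l` the weight `⌊re l⌋` makes it an equivariant dg module. The defining property
of `δ` says that `δ - s t : torsion X ⟶ torsion M` is a morphism of dg modules. It preserves the
positions of the poles, so its homotopy fibre `N` is equivariant. On cohomology `δ - s t` becomes
`E - t` on `H(X) ⊗ ℂ(t)/ℂ[t]`, which is onto, with kernel formed by the partial fraction expansions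
of `(t - E)⁻¹ v` for `v ∈ H(X)`; the residue recovers `v`. So the residue is a quasi-isomorphism
`N ⟶ X` (`quasiIso_residue`), and `M ← X ← N` is the required zigzag.
-/

namespace DGModule

variable {A : DGAlgebra.{u}}

@[simp]
theorem comp_toLin {M N P : DGModule A} (f : M ⟶ N) (g : N ⟶ P) :
    Hom.toLin (f ≫ g) = g.toLin ∘ₗ f.toLin := rfl

/-- The zero morphism. -/
def zeroHom (M N : DGModule A) : M ⟶ N :=
  { toLin := 0
    map_mem := fun n _ _ => (N.deg n).zero_mem
    map_d := fun m => by simp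
    map_act := fun m a => by simp : Hom M N }

/-! ### Quasi-isomorphisms and acyclicity in terms of cocycles -/

theorem cohomology_mk_eq_zero {V : Type u} [AddCommGroup V] [Module ℂ V] {d : V →ₗ[ℂ] V}
    (v : LinearMap.ker d) :
    (Submodule.Quotient.mk v : Cohomology d) = 0 ↔ ∃ w, d w = v := by
  rw [Submodule.Quotient.mk_eq_zero]
  rfl

theorem cohomology_mk_eq_iff {V : Type u} [AddCommGroup V] [Module ℂ V] {d : V →ₗ[ℂ] V}
    (v v' : LinearMap.ker d) :
    (Submodule.Quotient.mk v : Cohomology d) = Submodule.Quotient.mk v' ↔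
      ∃ w, d w = v - v' := by
  rw [Submodule.Quotient.eq]
  rfl

theorem quasiIso_iff {M N : DGModule A} (f : M ⟶ N) :
    quasiIso A f ↔
      (∀ x, M.d x = 0 → (∃ y, N.d y = f.toLin x) → ∃ w, M.d w = x) ∧
      (∀ y, N.d y = 0 → ∃ x, M.d x = 0 ∧ ∃ w, N.d w = y - f.toLin x) := by
  refine and_congr ?_ ?_
  · rw [← LinearMap.ker_eq_bot, LinearMap.ker_eq_bot']
    constructor
    · rintro h x hx hy
      exact (cohomology_mk_eq_zero ⟨x, hx⟩).1 (h _ ((cohomology_mk_eq_zero _).2 hy))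
    · intro h c hc
      obtain ⟨⟨x, hx⟩, rfl⟩ := Submodule.Quotient.mk_surjective _ c
      exact (cohomology_mk_eq_zero _).2 (h x hx ((cohomology_mk_eq_zero _).1 hc))
  · constructor
    · intro h y hy
      obtain ⟨c, hc⟩ := h (Submodule.Quotient.mk ⟨y, hy⟩)
      obtain ⟨⟨x, hx⟩, rfl⟩ := Submodule.Quotient.mk_surjective _ c
      exact ⟨x, hx, (cohomology_mk_eq_iff _ _).1 hc.symm⟩
    · intro h c
      obtain ⟨⟨y, hy⟩, rfl⟩ := Submodule.Quotient.mk_surjective _ c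
      obtain ⟨x, hx, hw⟩ := h y hy
      exact ⟨Submodule.Quotient.mk ⟨x, hx⟩, ((cohomology_mk_eq_iff _ _).2 hw).symm⟩

/-- A dg module is acyclic if every cocycle is a coboundary. -/
def IsAcyclic (M : DGModule A) : Prop := ∀ x, M.d x = 0 → ∃ w, M.d w = x

/-! ### Mapping cones and homotopy fibres -/

/-- The element `(m, n)` of the mapping cone. -/
def coneMk {M N : DGModule A} (f : M ⟶ N) (m : M.carrier) (n : N.carrier) : (cone f).carrier :=
  (m, n)

theorem cone_cases {M N : DGModule A} (f : M ⟶ N) (x : (cone f).carrier) :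
    ∃ m n, x = coneMk f m n := ⟨x.1, x.2, rfl⟩

theorem coneMk_inj {M N : DGModule A} {f : M ⟶ N} {m m' : M.carrier} {n n' : N.carrier} :
    coneMk f m n = coneMk f m' n' ↔ m = m' ∧ n = n' := Prod.mk_inj

theorem coneMk_eq_zero {M N : DGModule A} {f : M ⟶ N} {m : M.carrier} {n : N.carrier} :
    coneMk f m n = 0 ↔ m = 0 ∧ n = 0 := Prod.mk_eq_zero

theorem cone_d {M N : DGModule A} (f : M ⟶ N) (m : M.carrier) (n : N.carrier) :
    (cone f).d (coneMk f m n) = coneMk f (-M.d m) (f.toLin m + N.d n) := rfl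

theorem isAcyclic_cone {M N : DGModule A} {s : M ⟶ N} (hs : quasiIso A s) :
    (cone s).IsAcyclic := by
  intro x h
  obtain ⟨m, n, rfl⟩ := cone_cases s x
  rw [cone_d, coneMk_eq_zero] at h
  obtain ⟨h1, h2⟩ := h
  rw [quasiIso_iff] at hs
  have hm : M.d m = 0 := by simpa using h1
  obtain ⟨m1, hm1⟩ := hs.1 m hm ⟨-n, by rw [map_neg]; exact (eq_neg_of_add_eq_zero_left h2).symm⟩
  obtain ⟨z, hz, w, hw⟩ := hs.2 (s.toLin m1 + n) (by rw [map_add, ← s.map_d, hm1, h2])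
  refine ⟨coneMk s (z - m1) w, ?_⟩
  rw [cone_d, coneMk_inj]
  refine ⟨?_, ?_⟩
  · simp [hz, hm1]
  · simp only [map_sub, hw]; abel

/-- The homotopy fibre of a morphism `f`: the cone, shifted by `-1`. -/
noncomputable def fib {M N : DGModule A} (f : M ⟶ N) : DGModule A := (cone f).shift (-1)

/-- The element `(m, n)` of the homotopy fibre. -/
def fibMk {M N : DGModule A} (f : M ⟶ N) (m : M.carrier) (n : N.carrier) : (fib f).carrier :=
  (m, n)

theorem fib_cases {M N : DGModule A} (f : M ⟶ N) (x : (fib f).carrier) :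
    ∃ m n, x = fibMk f m n := ⟨x.1, x.2, rfl⟩

theorem fibMk_inj {M N : DGModule A} {f : M ⟶ N} {m m' : M.carrier} {n n' : N.carrier} :
    fibMk f m n = fibMk f m' n' ↔ m = m' ∧ n = n' := Prod.mk_inj

theorem fibMk_eq_zero {M N : DGModule A} {f : M ⟶ N} {m : M.carrier} {n : N.carrier} :
    fibMk f m n = 0 ↔ m = 0 ∧ n = 0 := Prod.mk_eq_zero

theorem isAcyclic_fib {M N : DGModule A} {s : M ⟶ N} (hs : quasiIso A s) :
    (fib s).IsAcyclic := by
  have hd : ∀ x : (cone s).carrier, (fib s).d x = -(cone s).d x := fun x => by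
    change (Int.negOnePow (-1)) • (cone s).d x = _
    simp
  intro x hx
  obtain ⟨w, hw⟩ := isAcyclic_cone hs x (neg_eq_zero.1 ((hd x).symm.trans hx))
  exact ⟨-w, (hd _).trans (by rw [map_neg, neg_neg, hw])⟩

theorem fib_d {M N : DGModule A} (f : M ⟶ N) (m : M.carrier) (n : N.carrier) :
    (fib f).d (fibMk f m n) = fibMk f (M.d m) (-(f.toLin m + N.d n)) := by
  change (Int.negOnePow (-1)) • ((-M.d m, f.toLin m + N.d n) : M.carrier × N.carrier) =
    (M.d m, -(f.toLin m + N.d n))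
  simp [add_comm]

theorem fib_act {M N : DGModule A} (f : M ⟶ N) (m : M.carrier) (n : N.carrier) (a : A.carrier) :
    (fib f).act (fibMk f m n) a = fibMk f (M.act m a) (N.act n a) := rfl

theorem fibMk_mem {M N : DGModule A} (f : M ⟶ N) {k : ℤ} {m : M.carrier} {n : N.carrier} :
    fibMk f m n ∈ (fib f).deg k ↔ m ∈ M.deg k ∧ n ∈ N.deg (k - 1) := by
  have : fibMk f m n ∈ (fib f).deg k ↔ m ∈ M.deg (k + -1 + 1) ∧ n ∈ N.deg (k + -1) := Iff.rfl
  rwa [neg_add_cancel_right, ← sub_eq_add_neg] at this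

/-- The projection of the homotopy fibre of `f` to the source of `f`. -/
noncomputable def fibFst {M N : DGModule A} (f : M ⟶ N) : fib f ⟶ M :=
  { toLin := (LinearMap.fst ℂ M.carrier N.carrier :)
    map_mem := fun n x h => by
      obtain ⟨m, n, rfl⟩ := fib_cases f x
      exact ((fibMk_mem f).1 h).1
    map_d := fun x => by
      obtain ⟨m, n, rfl⟩ := fib_cases f x
      rw [fib_d]
      rfl
    map_act := fun m a => rfl : Hom (fib f) M }

theorem fibFst_mk {M N : DGModule A} (f : M ⟶ N) (m : M.carrier) (n : N.carrier) :
    (fibFst f).toLin (fibMk f m n) = m := rfl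

/-- The second component of the homotopy fibre of `f`, as a linear map. -/
noncomputable def fibSnd {M N : DGModule A} (f : M ⟶ N) : (fib f).carrier →ₗ[ℂ] N.carrier :=
  (LinearMap.snd ℂ M.carrier N.carrier :)

theorem fibSnd_mk {M N : DGModule A} (f : M ⟶ N) (m : M.carrier) (n : N.carrier) :
    fibSnd f (fibMk f m n) = n := rfl

/-- The morphism to the homotopy fibre of `f` given by a morphism `g` to the source of `f` and a
null-homotopy `-h` of `g ≫ f`. -/
noncomputable def fibLift {L M N : DGModule A} (f : M ⟶ N) (g : L.carrier →ₗ[ℂ] M.carrier)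
    (h : L.carrier →ₗ[ℂ] N.carrier)
    (hg : ∀ n x, x ∈ L.deg n → g x ∈ M.deg n) (hh : ∀ n x, x ∈ L.deg n → h x ∈ N.deg (n - 1))
    (g_d : ∀ x, g (L.d x) = M.d (g x)) (h_d : ∀ x, h (L.d x) = -(f.toLin (g x) + N.d (h x)))
    (g_act : ∀ x a, g (L.act x a) = M.act (g x) a)
    (h_act : ∀ x a, h (L.act x a) = N.act (h x) a) : L ⟶ fib f :=
  { toLin := (g.prod h :)
    map_mem := fun n x hx => (fibMk_mem f).2 ⟨hg n x hx, hh n x hx⟩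
    map_d := fun x => by
      refine Eq.trans ?_ (fib_d f (g x) (h x)).symm
      exact Prod.ext (g_d x) (h_d x)
    map_act := fun x a => Prod.ext (g_act x a) (h_act x a) : Hom L (fib f) }

theorem quasiIso_fibFst {M N : DGModule A} (f : M ⟶ N) (hN : N.IsAcyclic) :
    quasiIso A (fibFst f) := by
  rw [quasiIso_iff]
  constructor
  · rintro x h ⟨y, hy⟩
    obtain ⟨x, n, rfl⟩ := fib_cases f x
    rw [fibFst_mk] at hy
    rw [fib_d, fibMk_eq_zero] at h
    obtain ⟨h1, h2⟩ := h
    obtain ⟨w, hw⟩ := hN (-n - f.toLin y) (by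
      rw [map_sub, map_neg, ← f.map_d, hy, ← h2]; abel)
    refine ⟨fibMk f y w, ?_⟩
    rw [fib_d, hw, hy, fibMk_inj]
    simp
  · intro y hy
    obtain ⟨w, hw⟩ := hN (-f.toLin y) (by rw [map_neg, ← f.map_d, hy, map_zero, neg_zero])
    refine ⟨fibMk f y w, ?_, 0, ?_⟩
    · rw [fib_d, hy, hw, fibMk_eq_zero]
      simp
    · rw [map_zero, fibFst_mk, sub_self]

/-! ### The homotopy category and its calculus of fractions -/

variable (A) in
/-- Total cohomology, as a functor. -/
noncomputable def cohomologyFunctor : DGModule A ⥤ ModuleCat.{u} ℂ where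
  obj M := ModuleCat.of ℂ (Cohomology M.d)
  map f := ModuleCat.ofHom (cohomologyMap f)
  map_id M := by
    ext c
    rfl
  map_comp f g := by
    ext c
    rfl

theorem isIso_cohomologyFunctor_map {M N : DGModule A} (f : M ⟶ N) :
    IsIso ((cohomologyFunctor A).map f) ↔ quasiIso A f :=
  ConcreteCategory.isIso_iff_bijective _

theorem quasiIso_comp {M N P : DGModule A} {f : M ⟶ N} {g : N ⟶ P} (hf : quasiIso A f)
    (hg : quasiIso A g) : quasiIso A (f ≫ g) := by
  rw [← isIso_cohomologyFunctor_map] at *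
  rw [Functor.map_comp]
  infer_instance

/-- Two morphisms of dg modules are homotopic if their difference is `d h + h d` for an `A`-linear
map `h` of degree `-1`. (For right modules, no sign appears in the linearity of `h`.) -/
def Homotopic : HomRel (DGModule A) := fun M N f g =>
  ∃ h : M.carrier →ₗ[ℂ] N.carrier, (∀ n x, x ∈ M.deg n → h x ∈ N.deg (n - 1)) ∧
    (∀ x a, h (M.act x a) = N.act (h x) a) ∧
    ∀ x, f.toLin x - g.toLin x = N.d (h x) + h (M.d x)

instance : Congruence (Homotopic (A := A)) where
  comp_left := by
    rintro X Y Z f g g' ⟨h, h1, h2, h3⟩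
    refine ⟨h ∘ₗ f.toLin, fun n x hx => h1 n _ (f.map_mem n x hx), fun x a => ?_, fun x => ?_⟩
    · simp only [LinearMap.comp_apply, f.map_act, h2]
    · simpa only [comp_toLin, LinearMap.comp_apply, f.map_d] using h3 (f.toLin x)
  comp_right := by
    rintro X Y Z f f' g ⟨h, h1, h2, h3⟩
    refine ⟨g.toLin ∘ₗ h, fun n x hx => g.map_mem _ _ (h1 n x hx), fun x a => ?_, fun x => ?_⟩
    · simp only [LinearMap.comp_apply, g.map_act, h2]
    · simp only [comp_toLin, LinearMap.comp_apply, ← map_sub, h3, map_add, g.map_d]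
  equivalence := by
    refine ⟨fun f => ⟨0, fun n x _ => Submodule.zero_mem _, by simp, by simp⟩, ?_, ?_⟩
    · rintro f g ⟨h, h1, h2, h3⟩
      refine ⟨-h, fun n x hx => Submodule.neg_mem _ (h1 n x hx), by simp [h2], fun x => ?_⟩
      rw [← neg_sub, h3]
      simp [add_comm]
    · rintro f g k ⟨h, h1, h2, h3⟩ ⟨h', h1', h2', h3'⟩
      refine ⟨h + h', fun n x hx => Submodule.add_mem _ (h1 n x hx) (h1' n x hx),
        by simp [h2, h2'], fun x => ?_⟩
      rw [← sub_add_sub_cancel _ (g.toLin x), h3, h3']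
      simp only [LinearMap.add_apply, map_add]
      abel

theorem Homotopic.cohomologyMap_eq {M N : DGModule A} {f g : M ⟶ N} (h : Homotopic f g) :
    cohomologyMap f = cohomologyMap g := by
  obtain ⟨h, -, -, hd⟩ := h
  refine LinearMap.ext fun c => ?_
  obtain ⟨⟨x, hx⟩, rfl⟩ := Submodule.Quotient.mk_surjective _ c
  refine (cohomology_mk_eq_iff _ _).2 ⟨h x, ?_⟩
  have := hd x
  rw [LinearMap.mem_ker.1 hx, map_zero, add_zero] at this
  exact this.symm

variable (A) in
/-- The homotopy category of dg modules. -/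
abbrev HomotopyCat : Type (u + 1) := CategoryTheory.Quotient (Homotopic (A := A))

variable (A) in
/-- The projection of the category of dg modules to the homotopy category. -/
abbrev HomotopyCat.quotient : DGModule A ⥤ HomotopyCat A :=
  CategoryTheory.Quotient.functor (Homotopic (A := A))

variable (A) in
/-- Cohomology on the homotopy category. -/
noncomputable def homotopyCohomology : HomotopyCat A ⥤ ModuleCat.{u} ℂ :=
  CategoryTheory.Quotient.lift _ (cohomologyFunctor A) fun _ _ _ _ h =>
    congrArg ModuleCat.ofHom h.cohomologyMap_eq

variable (A) in
/-- Quasi-isomorphisms in the homotopy category. -/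
def homotopyQuasiIso : MorphismProperty (HomotopyCat A) :=
  (MorphismProperty.isomorphisms _).inverseImage (homotopyCohomology A)

theorem homotopyQuasiIso_map {M N : DGModule A} (f : M ⟶ N) :
    homotopyQuasiIso A ((HomotopyCat.quotient A).map f) ↔ quasiIso A f :=
  isIso_cohomologyFunctor_map f

/-- The Ore condition: a quasi-isomorphism `s` can be pulled back along `f`, up to homotopy. The
pullback is the homotopy fibre of the composite of `f` with the inclusion of `Y` into the
acyclic cone of `s`. -/
theorem exists_ore {X Y Y' : DGModule A} (f : X ⟶ Y) (s : Y' ⟶ Y) (hs : quasiIso A s) :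
    ∃ (X' : DGModule A) (t : X' ⟶ X) (g : X' ⟶ Y'), quasiIso A t ∧
      Homotopic (t ≫ f) (g ≫ s) := by
  let i : X ⟶ cone s :=
    { toLin := (LinearMap.inr ℂ Y'.carrier Y.carrier ∘ₗ f.toLin :)
      map_mem := fun n x hx => ⟨Submodule.zero_mem _, f.map_mem n x hx⟩
      map_d := fun x => by
        refine Eq.trans ?_ (cone_d s 0 (f.toLin x)).symm
        rw [map_zero, map_zero, neg_zero, zero_add, ← f.map_d]
        rfl
      map_act := fun x a => by
        refine Prod.ext ?_ (f.map_act x a)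
        exact (LinearMap.map_zero₂ Y'.act a).symm : Hom X (cone s) }
  have hi : ∀ x, i.toLin x = coneMk s 0 (f.toLin x) := fun x => rfl
  let p1 : (cone s).carrier →ₗ[ℂ] Y'.carrier := (LinearMap.fst ℂ Y'.carrier Y.carrier :)
  let p2 : (cone s).carrier →ₗ[ℂ] Y.carrier := (LinearMap.snd ℂ Y'.carrier Y.carrier :)
  have hp1 : ∀ m n, p1 (coneMk s m n) = m := fun m n => rfl
  have hp2 : ∀ m n, p2 (coneMk s m n) = n := fun m n => rfl
  let g : fib i ⟶ Y' :=
    { toLin := -(p1 ∘ₗ fibSnd i)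
      map_mem := fun n x hx => by
        obtain ⟨x, y, rfl⟩ := fib_cases i x
        have := ((fibMk_mem i).1 hx).2.1
        rw [sub_add_cancel] at this
        exact Submodule.neg_mem _ this
      map_d := fun x => by
        obtain ⟨x, y, rfl⟩ := fib_cases i x
        obtain ⟨y', y, rfl⟩ := cone_cases s y
        simp [fib_d, fibSnd_mk, cone_d, hp1, hi]
      map_act := fun x a => by
        obtain ⟨x, y, rfl⟩ := fib_cases i x
        obtain ⟨y', y, rfl⟩ := cone_cases s y
        simp only [fib_act, fibSnd_mk, LinearMap.neg_apply, LinearMap.comp_apply, map_neg]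
        rfl : Hom (fib i) Y' }
  refine ⟨fib i, fibFst i, g, quasiIso_fibFst i (isAcyclic_cone hs), -(p2 ∘ₗ fibSnd i), ?_, ?_, ?_⟩
  · intro n x hx
    obtain ⟨x, y, rfl⟩ := fib_cases i x
    exact Submodule.neg_mem _ ((fibMk_mem i).1 hx).2.2
  · intro x a
    obtain ⟨x, y, rfl⟩ := fib_cases i x
    simp only [fib_act, fibSnd_mk, LinearMap.neg_apply, LinearMap.comp_apply, map_neg]
    rfl
  · intro x
    obtain ⟨x, y, rfl⟩ := fib_cases i x
    obtain ⟨y', y, rfl⟩ := cone_cases s y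
    simp only [comp_toLin, LinearMap.comp_apply, fibFst_mk, fib_d, LinearMap.neg_apply, fibSnd_mk,
      map_neg, map_add, cone_d, hp1, hp2, hi, g]
    abel

/-- A homotopy between `f ≫ s` and `g ≫ s`, for a quasi-isomorphism `s`, gives a homotopy between
`f` and `g` after precomposition with a quasi-isomorphism. -/
theorem exists_homotopic_of_comp {X Y Z : DGModule A} (f g : X ⟶ Y) (s : Y ⟶ Z)
    (hs : quasiIso A s) (h : Homotopic (f ≫ s) (g ≫ s)) :
    ∃ (X' : DGModule A) (t : X' ⟶ X), quasiIso A t ∧ Homotopic (t ≫ f) (t ≫ g) := by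
  obtain ⟨h, h1, h2, h3⟩ := h
  let i : X ⟶ fib s := fibLift s (f.toLin - g.toLin) (-h)
    (fun n x hx => Submodule.sub_mem _ (f.map_mem n x hx) (g.map_mem n x hx))
    (fun n x hx => Submodule.neg_mem _ (h1 n x hx))
    (fun x => by simp [f.map_d, g.map_d])
    (fun x => by
      have := h3 x
      simp only [comp_toLin, LinearMap.comp_apply] at this
      simp [this])
    (fun x a => by simp [f.map_act, g.map_act])
    (fun x a => by simp [h2])
  have hi : ∀ x, i.toLin x = fibMk s (f.toLin x - g.toLin x) (-h x) := fun x => rfl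
  refine ⟨fib i, fibFst i, quasiIso_fibFst i (isAcyclic_fib hs), -((fibFst s).toLin ∘ₗ fibSnd i), ?_, ?_, ?_⟩
  · intro n x hx
    obtain ⟨x, y, rfl⟩ := fib_cases i x
    exact Submodule.neg_mem _ ((fibFst s).map_mem _ _ ((fibMk_mem i).1 hx).2)
  · intro x a
    obtain ⟨x, y, rfl⟩ := fib_cases i x
    simp only [fib_act, fibSnd_mk, LinearMap.neg_apply, LinearMap.comp_apply, map_neg,
      (fibFst s).map_act]
  · intro x
    obtain ⟨x, y, rfl⟩ := fib_cases i x
    simp only [comp_toLin, LinearMap.comp_apply, fibFst_mk, fib_d, LinearMap.neg_apply, fibSnd_mk,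
      map_neg, map_add, hi, ← (fibFst s).map_d]
    abel

instance : (homotopyQuasiIso A).IsMultiplicative := by
  unfold homotopyQuasiIso
  infer_instance

instance : (homotopyQuasiIso A).HasRightCalculusOfFractions where
  exists_rightFraction := by
    rintro ⟨X⟩ ⟨Y⟩ ⟨(f : (HomotopyCat.quotient A).obj X ⟶ (HomotopyCat.quotient A).obj _),
      (s : (HomotopyCat.quotient A).obj Y ⟶ (HomotopyCat.quotient A).obj _), hs⟩
    obtain ⟨f, rfl⟩ := (HomotopyCat.quotient A).map_surjective f
    obtain ⟨s, rfl⟩ := (HomotopyCat.quotient A).map_surjective s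
    obtain ⟨X', t, g, ht, h⟩ := exists_ore f s ((homotopyQuasiIso_map s).1 hs)
    refine ⟨⟨(HomotopyCat.quotient A).map t, (homotopyQuasiIso_map t).2 ht,
      (HomotopyCat.quotient A).map g⟩, ?_⟩
    exact CategoryTheory.Quotient.sound _ h
  ext := by
    rintro ⟨X⟩ ⟨Y⟩ ⟨Z⟩ f g s hs h
    obtain ⟨f, rfl⟩ := (HomotopyCat.quotient A).map_surjective f
    obtain ⟨g, rfl⟩ := (HomotopyCat.quotient A).map_surjective g
    obtain ⟨s, rfl⟩ := (HomotopyCat.quotient A).map_surjective s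
    rw [← Functor.map_comp, ← Functor.map_comp, CategoryTheory.Quotient.functor_map_eq_iff] at h
    obtain ⟨X', t, ht, h'⟩ := exists_homotopic_of_comp f g s ((homotopyQuasiIso_map s).1 hs) h
    exact ⟨_, (HomotopyCat.quotient A).map t, (homotopyQuasiIso_map t).2 ht, CategoryTheory.Quotient.sound _ h'⟩

/-- Two morphisms of dg modules that agree in the derived category become homotopic after
precomposition with a quasi-isomorphism. -/
theorem exists_homotopic_of_Q_map_eq {X Y : DGModule A} (f g : X ⟶ Y)
    (h : (quasiIso A).Q.map f = (quasiIso A).Q.map g) :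
    ∃ (X' : DGModule A) (t : X' ⟶ X), quasiIso A t ∧ Homotopic (t ≫ f) (t ≫ g) := by
  let L := HomotopyCat.quotient A ⋙ (homotopyQuasiIso A).Q
  have hL : (quasiIso A).IsInvertedBy L := fun M N s hs =>
    Localization.inverts (homotopyQuasiIso A).Q (homotopyQuasiIso A) _
      ((homotopyQuasiIso_map s).2 hs)
  have h' : L.map f = L.map g := by
    have e := Localization.fac L hL (quasiIso A).Q
    rw [← NatIso.naturality_1 e f, ← NatIso.naturality_1 e g, Functor.comp_map, Functor.comp_map, h]
  obtain ⟨⟨X'⟩, t, ht, h''⟩ :=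
    (MorphismProperty.map_eq_iff_precomp (homotopyQuasiIso A).Q (homotopyQuasiIso A) _ _).1 h'
  obtain ⟨t, rfl⟩ := (HomotopyCat.quotient A).map_surjective t
  exact ⟨X', t, (homotopyQuasiIso_map t).1 ht, (CategoryTheory.Quotient.functor_map_eq_iff _ _ _).1
    (by simpa only [Functor.map_comp] using h'')⟩

/-! ### Finite-dimensionality of the cohomology of perfect modules -/

/-- The map on cohomology induced by a linear map that commutes with the differentials up to
sign, or more generally preserves cocycles and coboundaries. -/
def cohomologyLift {V W : Type u} [AddCommGroup V] [Module ℂ V] [AddCommGroup W] [Module ℂ W]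
    {d : V →ₗ[ℂ] V} {d' : W →ₗ[ℂ] W} (f : V →ₗ[ℂ] W) (hker : ∀ x, d x = 0 → d' (f x) = 0)
    (hrange : ∀ x, ∃ w, d' w = f (d x)) : Cohomology d →ₗ[ℂ] Cohomology d' :=
  Submodule.mapQ _ _ (f.restrict (p := LinearMap.ker d) (q := LinearMap.ker d') hker)
    (by
      rintro ⟨_, hm⟩ ⟨x, rfl⟩
      exact hrange x)

theorem finiteDimensional_cohomology_units_smul {V : Type u} [AddCommGroup V] [Module ℂ V]
    (d : V →ₗ[ℂ] V) (u : ℤˣ) (h : FiniteDimensional ℂ (Cohomology d)) :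
    FiniteDimensional ℂ (Cohomology (u • d)) := by
  rcases Int.units_eq_one_or u with rfl | rfl
  · rwa [one_smul]
  · refine Module.Finite.of_surjective (cohomologyLift (d := d) (d' := (-1 : ℤˣ) • d)
      LinearMap.id (fun x hx => by simp [hx]) (fun x => ⟨-x, by simp⟩)) fun c => ?_
    obtain ⟨⟨x, hx⟩, rfl⟩ := Submodule.Quotient.mk_surjective _ c
    exact ⟨Submodule.Quotient.mk ⟨x, by simpa using hx⟩, rfl⟩

/-- The sequence `H(N) → H(cone f) → H(M)` is exact in the middle. -/
theorem finiteDimensional_cohomology_cone {M N : DGModule A} (f : M ⟶ N)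
    (hM : FiniteDimensional ℂ (Cohomology M.d)) (hN : FiniteDimensional ℂ (Cohomology N.d)) :
    FiniteDimensional ℂ (Cohomology (cone f).d) := by
  let inr : N.carrier →ₗ[ℂ] (cone f).carrier := (LinearMap.inr ℂ M.carrier N.carrier :)
  have hinr : ∀ n, inr n = coneMk f 0 n := fun n => rfl
  let fst : (cone f).carrier →ₗ[ℂ] M.carrier := (LinearMap.fst ℂ M.carrier N.carrier :)
  have hfst : ∀ m n, fst (coneMk f m n) = m := fun m n => rfl
  let i : Cohomology N.d →ₗ[ℂ] Cohomology (cone f).d := cohomologyLift inr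
    (fun x hx => by simp [hinr, cone_d, hx, coneMk_eq_zero])
    (fun x => ⟨inr x, by simp [hinr, cone_d]⟩)
  let p : Cohomology (cone f).d →ₗ[ℂ] Cohomology M.d := cohomologyLift fst
    (fun x hx => by
      obtain ⟨m, n, rfl⟩ := cone_cases f x
      rw [cone_d, coneMk_eq_zero] at hx
      simpa [hfst] using hx.1)
    (fun x => by
      obtain ⟨m, n, rfl⟩ := cone_cases f x
      exact ⟨-m, by simp [hfst, cone_d]⟩)
  have hker : LinearMap.ker p ≤ LinearMap.range i := by
    intro c hc
    obtain ⟨⟨x, hx⟩, rfl⟩ := Submodule.Quotient.mk_surjective _ c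
    obtain ⟨m, n, rfl⟩ := cone_cases f x
    obtain ⟨w, hw⟩ := (cohomology_mk_eq_zero _).1 hc
    replace hw : M.d w = m := hw
    subst hw
    rw [LinearMap.mem_ker, cone_d, coneMk_eq_zero, f.map_d] at hx
    refine ⟨Submodule.Quotient.mk ⟨f.toLin w + n, by simpa using hx.2⟩,
      (cohomology_mk_eq_iff _ _).2 ⟨coneMk f w 0, ?_⟩⟩
    have : inr (f.toLin w + n) - coneMk f (M.d w) n = coneMk f (0 - M.d w) (f.toLin w + n - n) :=
      rfl
    refine Eq.trans ?_ this.symm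
    rw [cone_d, coneMk_inj]
    simp
  refine ⟨Submodule.fg_of_fg_map_of_fg_inf_ker p (IsNoetherian.noetherian _) ?_⟩
  rw [top_inf_eq]
  have : FiniteDimensional ℂ (LinearMap.range i) := inferInstance
  exact (Module.Finite.iff_fg.1 this).of_le hker

theorem finiteDimensional_cohomology_of_isFiniteCell (hA : A.IsProper) {M : DGModule A}
    (h : IsFiniteCell M) : FiniteDimensional ℂ (Cohomology M.d) := by
  induction h with
  | free => exact hA
  | shift M n _ ih => exact finiteDimensional_cohomology_units_smul M.d n.negOnePow ih
  | cone f _ _ hM hN => exact finiteDimensional_cohomology_cone f hM hN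

theorem finiteDimensional_cohomology_of_isPerfect (hA : A.IsProper) {M : DGModule A}
    (h : IsPerfect M) : FiniteDimensional ℂ (Cohomology M.d) := by
  obtain ⟨P, hP, ⟨r⟩⟩ := h
  have hinv : (quasiIso A).IsInvertedBy (cohomologyFunctor A) := fun M N s hs =>
    (isIso_cohomologyFunctor_map s).2 hs
  let H := Localization.lift (cohomologyFunctor A) hinv (quasiIso A).Q
  let e : (quasiIso A).Q ⋙ H ≅ cohomologyFunctor A := Localization.fac _ hinv (quasiIso A).Q
  let r' : Retract ((cohomologyFunctor A).obj M) ((cohomologyFunctor A).obj P) :=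
    (Retract.ofIso (e.app M).symm).trans ((r.map H).trans (Retract.ofIso (e.app P)))
  have hP' : FiniteDimensional ℂ (Cohomology P.d) :=
    finiteDimensional_cohomology_of_isFiniteCell hA hP
  have hinj : Function.Injective r'.i.hom := by
    refine Function.LeftInverse.injective (g := r'.r.hom) fun x => ?_
    have := r'.retract
    exact congrArg (fun k => k.hom x) this
  let i : Cohomology M.d →ₗ[ℂ] Cohomology P.d := r'.i.hom
  exact FiniteDimensional.of_injective i hinj

end DGModule

/-! ### Weights of a rational action -/

/-- A Laurent polynomial with coefficients in a vector space that vanishes at all points of `ℂ^*`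
is zero. -/
theorem laurent_eq_zero {V : Type u} [AddCommGroup V] [Module ℂ V] (c : ℤ →₀ V)
    (h : ∀ z : ℂˣ, (c.sum fun k w => ((z ^ k : ℂˣ) : ℂ) • w) = 0) : c = 0 := by
  by_contra hc
  obtain ⟨k, hk⟩ := Finsupp.ne_iff.1 hc
  obtain ⟨φ, hφ⟩ : ∃ φ : Module.Dual ℂ V, φ (c k) ≠ 0 := by
    by_contra! h'
    exact hk ((Module.forall_dual_apply_eq_zero_iff ℂ _).1 h')
  let χ : ℤ → (ℂˣ →* ℂ) := fun k => (Units.coeHom ℂ).comp (zpowGroupHom k)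
  have hχ : Function.Injective χ := fun i j hij => by
    have h2 := DFunLike.congr_fun hij (Units.mk0 (2 : ℂ) two_ne_zero)
    have h3 : (2 : ℂ) ^ i = 2 ^ j := by simpa [χ] using h2
    have h4 : (2 : ℝ) ^ i = 2 ^ j := by simpa using congrArg norm h3
    exact zpow_right_injective₀ two_pos (by norm_num) h4
  have hli := (linearIndependent_monoidHom ℂˣ ℂ).comp χ hχ
  have := linearIndependent_iff.1 hli (c.mapRange φ (map_zero φ)) (by
    ext z
    have := congrArg φ (h z)
    rw [map_zero, Finsupp.sum, map_sum] at this
    rw [Finsupp.linearCombination_apply, Finsupp.sum_mapRange_index (by simp), Finsupp.sum,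
      Finset.sum_apply, Pi.zero_apply, ← this]
    refine Finset.sum_congr rfl fun k _ => ?_
    simp [χ, mul_comm])
  exact hφ (by simpa using DFunLike.congr_fun this k)

theorem laurent_unique {V : Type u} [AddCommGroup V] [Module ℂ V] {c c' : ℤ →₀ V}
    (h : ∀ z : ℂˣ, (c.sum fun k w => ((z ^ k : ℂˣ) : ℂ) • w) =
      c'.sum fun k w => ((z ^ k : ℂˣ) : ℂ) • w) : c = c' := by
  rw [← sub_eq_zero]
  refine laurent_eq_zero _ fun z => ?_
  rw [Finsupp.sum_sub_index (fun k a b => smul_sub _ a b), h, sub_self]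

namespace IsRationalRep

variable {V : Type u} [AddCommGroup V] [Module ℂ V] {ρ : Representation ℂ ℂˣ V}

theorem laurent_map {W : Type u} [AddCommGroup W] [Module ℂ W] (f : V →ₗ[ℂ] W) (c : ℤ →₀ V)
    (z : ℂˣ) : f (c.sum fun k w => ((z ^ k : ℂˣ) : ℂ) • w) =
      (c.mapRange f (map_zero f)).sum fun k w => ((z ^ k : ℂˣ) : ℂ) • w := by
  rw [Finsupp.sum_mapRange_index (by simp), Finsupp.sum, map_sum]
  simp [Finsupp.sum]

/-- The coaction `V → V ⊗ ℂ[z, z⁻¹]` of a rational representation: the coefficients of the orbit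
maps. -/
noncomputable def coaction (h : IsRationalRep ρ) : V →ₗ[ℂ] (ℤ →₀ V) where
  toFun v := (h v).choose
  map_add' v w := laurent_unique fun z => by
    rw [Finsupp.sum_add_index' (by simp) (by simp), ← (h _).choose_spec, ← (h _).choose_spec,
      ← (h _).choose_spec, map_add]
  map_smul' a v := laurent_unique fun z => by
    rw [Finsupp.sum_smul_index' (by simp), ← (h _).choose_spec, map_smul, RingHom.id_apply,
      (h v).choose_spec z, Finsupp.smul_sum]
    exact Finsupp.sum_congr fun k _ => smul_comm _ _ _

theorem apply_eq_sum (h : IsRationalRep ρ) (z : ℂˣ) (v : V) :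
    ρ z v = (h.coaction v).sum fun k w => ((z ^ k : ℂˣ) : ℂ) • w :=
  (h v).choose_spec z

variable (ρ) in
/-- The vectors of weight `k`. -/
def weightSpace (k : ℤ) : Submodule ℂ V where
  carrier := {v | ∀ z : ℂˣ, ρ z v = ((z ^ k : ℂˣ) : ℂ) • v}
  add_mem' hv hw z := by rw [map_add, hv, hw, smul_add]
  zero_mem' z := by rw [map_zero, smul_zero]
  smul_mem' a v hv z := by rw [map_smul, hv, smul_comm]

theorem coaction_of_mem (h : IsRationalRep ρ) {k : ℤ} {v : V} (hv : v ∈ weightSpace ρ k) :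
    h.coaction v = Finsupp.single k v :=
  laurent_unique fun z => by rw [← h.apply_eq_sum, hv z, Finsupp.sum_single_index (by simp)]

theorem coaction_apply_mem (h : IsRationalRep ρ) (v : V) (k : ℤ) :
    h.coaction v k ∈ weightSpace ρ k := by
  intro w
  have : (h.coaction v).mapRange (ρ w) (map_zero _) =
      Finsupp.onFinset (h.coaction v).support (fun k => ((w ^ k : ℂˣ) : ℂ) • h.coaction v k)
        (fun k hk => by
          rw [Finsupp.mem_support_iff]
          intro h0
          exact hk (by rw [h0, smul_zero])) := laurent_unique fun z => by
    rw [← laurent_map, ← h.apply_eq_sum, Finsupp.onFinset_sum _ (by simp), ← Module.End.mul_apply,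
      ← map_mul, h.apply_eq_sum]
    refine Finset.sum_congr rfl fun k _ => ?_
    rw [smul_smul, mul_comm w, ← Units.val_mul, ← mul_zpow]
  simpa using DFunLike.congr_fun this k

theorem sum_coaction (h : IsRationalRep ρ) (v : V) : ((h.coaction v).sum fun _ w => w) = v := by
  have := h.apply_eq_sum 1 v
  simpa using this.symm

/-- A stable subspace contains the weight components of its elements: their images in the quotient
are the coefficients of a vanishing Laurent polynomial. -/
theorem coaction_mem_of_stable (h : IsRationalRep ρ) (p : Submodule ℂ V)
    (hp : ∀ z, ∀ v ∈ p, ρ z v ∈ p) {v : V} (hv : v ∈ p) (k : ℤ) : h.coaction v k ∈ p := by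
  have : (h.coaction v).mapRange p.mkQ (map_zero _) = 0 := laurent_eq_zero _ fun z => by
    rw [← laurent_map, ← h.apply_eq_sum, Submodule.mkQ_apply, Submodule.Quotient.mk_eq_zero]
    exact hp z v hv
  simpa using DFunLike.congr_fun this k

theorem weight_induction (h : IsRationalRep ρ) {P : V → Prop} (v : V) (zero : P 0)
    (add : ∀ v w, P v → P w → P (v + w)) (weight : ∀ k, ∀ v ∈ weightSpace ρ k, P v) : P v := by
  rw [← h.sum_coaction v]
  exact Finset.sum_induction _ P (fun v w => add v w) zero
    fun k _ => weight k _ (h.coaction_apply_mem v k)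

end IsRationalRep

namespace DGAlgebra.RationalAction

variable {A : DGAlgebra.{u}} (α : A.RationalAction)

/-! ### The Euler derivation -/

/-- The elements of `A` of weight `k`. -/
def weight (k : ℤ) : Submodule ℂ A.carrier := IsRationalRep.weightSpace α.ρ k

theorem one_mem_weight : (1 : A.carrier) ∈ α.weight 0 := fun z => by simp [α.map_one]

theorem mul_mem_weight {k l : ℤ} {a b : A.carrier} (ha : a ∈ α.weight k) (hb : b ∈ α.weight l) :
    a * b ∈ α.weight (k + l) := fun z => by
  rw [α.map_mul, ha z, hb z, smul_mul_smul_comm, zpow_add, Units.val_mul]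

theorem d_mem_weight {k : ℤ} {a : A.carrier} (ha : a ∈ α.weight k) : A.d a ∈ α.weight k :=
  fun z => by rw [α.map_d, ha z, map_smul]

/-- The derivation of `A` that generates the action: multiplication by `k` on the elements of
weight `k`. -/
noncomputable def euler : A.carrier →ₗ[ℂ] A.carrier :=
  Finsupp.lsum ℂ (fun k : ℤ => (k : ℂ) • LinearMap.id) ∘ₗ α.rational.coaction

theorem euler_apply (a : A.carrier) :
    α.euler a = (α.rational.coaction a).sum fun k b => (k : ℂ) • b := by
  simp only [euler, LinearMap.comp_apply, Finsupp.lsum_apply]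
  rfl

theorem euler_of_mem {k : ℤ} {a : A.carrier} (ha : a ∈ α.weight k) :
    α.euler a = (k : ℂ) • a := by
  rw [euler_apply, α.rational.coaction_of_mem ha, Finsupp.sum_single_index (by simp)]

theorem euler_mem {n : ℤ} {a : A.carrier} (ha : a ∈ A.deg n) : α.euler a ∈ A.deg n := by
  rw [euler_apply]
  exact Submodule.sum_mem _ fun k _ => Submodule.smul_mem _ _
    (α.rational.coaction_mem_of_stable (A.deg n) (fun z b hb => α.map_mem z n b hb) ha k)

theorem euler_one : α.euler 1 = 0 := by
  rw [α.euler_of_mem α.one_mem_weight, Int.cast_zero, zero_smul]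

theorem euler_d (a : A.carrier) : α.euler (A.d a) = A.d (α.euler a) := by
  induction a using α.rational.weight_induction with
  | zero => simp
  | add a b ha hb => simp only [map_add, ha, hb]
  | weight k a ha => rw [α.euler_of_mem ha, α.euler_of_mem (α.d_mem_weight ha), map_smul]

theorem euler_mul (a b : A.carrier) : α.euler (a * b) = α.euler a * b + a * α.euler b := by
  induction a using α.rational.weight_induction with
  | zero => simp
  | add a a' ha ha' => simp only [map_add, add_mul, ha, ha']; abel
  | weight k a ha =>
    induction b using α.rational.weight_induction with
    | zero => simp
    | add b b' hb hb' => simp only [map_add, mul_add, hb, hb']; abel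
    | weight l b hb =>
      rw [α.euler_of_mem ha, α.euler_of_mem hb, α.euler_of_mem (α.mul_mem_weight ha hb),
        Int.cast_add, add_smul, smul_mul_assoc, mul_smul_comm]

end DGAlgebra.RationalAction

namespace DGModule

variable {A : DGAlgebra.{u}}

/-! ### The Atiyah extension -/

/-- The Atiyah extension of `M`: the first-order deformation of `M` along the action of `ℂ^*` on
`A`, an extension of `M` by itself. -/
noncomputable def atiyah (α : A.RationalAction) (M : DGModule A) : DGModule A where
  carrier := M.carrier × M.carrier
  deg := fun k => (M.deg k).prod (M.deg k)
  graded := prodDecomposition M.deg M.deg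
  d := M.d.prodMap M.d
  d_mem := fun k m h => ⟨M.d_mem _ _ h.1, M.d_mem _ _ h.2⟩
  d_d := fun m => by simp [M.d_d]
  act := LinearMap.mk₂ ℂ (fun x a => (M.act x.1 a, M.act x.2 a + M.act x.1 (α.euler a)))
    (fun x y a => by simp [add_add_add_comm]) (fun c x a => by simp)
    (fun x a b => by simp [add_add_add_comm]) (fun c x a => by simp)
  act_mem := fun i j m a hm ha => ⟨M.act_mem i j _ a hm.1 ha,
    Submodule.add_mem _ (M.act_mem i j _ a hm.2 ha) (M.act_mem i j _ _ hm.1 (α.euler_mem ha))⟩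
  act_one := fun m => by simp [act_one, α.euler_one]
  act_mul := fun m a b => by simp [act_mul, α.euler_mul]; abel
  leibniz := fun k m a h => by
    have h1 := M.leibniz _ m.1 a h.1
    have h2 := M.leibniz _ m.2 a h.2
    have h3 := M.leibniz _ m.1 (α.euler a) h.1
    refine Prod.ext ?_ ?_
    · simp [h1]
    · simp [h2, h3, α.euler_d]; abel

/-- The element `(m, m')` of the Atiyah extension. -/
def atiyahMk (α : A.RationalAction) (M : DGModule A) (m m' : M.carrier) :
    (atiyah α M).carrier := (m, m')

/-- The inclusion of `M` in its Atiyah extension. -/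
noncomputable def atiyahIncl (α : A.RationalAction) (M : DGModule A) : M ⟶ atiyah α M :=
  { toLin := (LinearMap.inr ℂ M.carrier M.carrier :)
    map_mem := fun n x hx => ⟨Submodule.zero_mem _, hx⟩
    map_d := fun x => Prod.ext (map_zero M.d).symm rfl
    map_act := fun x a => Prod.ext (LinearMap.map_zero₂ M.act a).symm
      (by
        change M.act x a = M.act x a + M.act 0 (α.euler a)
        rw [LinearMap.map_zero₂, add_zero]) : Hom M (atiyah α M) }

/-- A connection on `M`, relative to a resolution `s : X ⟶ M`: a linear map of degree `0` which
commutes with the differentials and covers the derivation `euler` of `A`. -/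
structure Connection (α : A.RationalAction) {X M : DGModule A} (s : X ⟶ M) where
  toLin : X.carrier →ₗ[ℂ] M.carrier
  map_mem : ∀ n x, x ∈ X.deg n → toLin x ∈ M.deg n
  map_d : ∀ x, toLin (X.d x) = M.d (toLin x)
  map_act : ∀ x a, toLin (X.act x a) = M.act (toLin x) a + M.act (s.toLin x) (α.euler a)

/-- The Atiyah extension is classified by the morphism `M ⟶ M[1]` of the derived category given by
the fraction `M ← cone (M ⟶ atiyah M) → M[1]`. If it vanishes, a null-homotopy of the numerator
on a resolution `X` of the cone splits the extension over `X`, and this is a connection. -/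
theorem exists_connection (α : A.RationalAction) (M : DGModule A) (hM : IsRigid M) :
    ∃ (X : DGModule A) (s : X ⟶ M), quasiIso A s ∧ Nonempty (Connection α s) := by
  let ι := atiyahIncl α M
  let C := cone ι
  let c0 : C.carrier →ₗ[ℂ] M.carrier := (LinearMap.fst ℂ M.carrier (M.carrier × M.carrier) :)
  let c1 : C.carrier →ₗ[ℂ] M.carrier :=
    (LinearMap.fst ℂ M.carrier M.carrier ∘ₗ LinearMap.snd ℂ M.carrier (M.carrier × M.carrier) :)
  let c2 : C.carrier →ₗ[ℂ] M.carrier :=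
    (LinearMap.snd ℂ M.carrier M.carrier ∘ₗ LinearMap.snd ℂ M.carrier (M.carrier × M.carrier) :)
  have hC : ∀ m m1 m2, C.d (coneMk ι m (atiyahMk α M m1 m2)) =
      coneMk ι (-M.d m) (atiyahMk α M (M.d m1) (m + M.d m2)) := fun m m1 m2 => by
    refine congrArg (coneMk ι (-M.d m)) ?_
    exact Prod.ext (zero_add _) rfl
  have hc0d : ∀ x, c0 (C.d x) = -M.d (c0 x) := fun x => rfl
  have hc1d : ∀ x, c1 (C.d x) = M.d (c1 x) := fun x => zero_add _
  have hc2d : ∀ x, c2 (C.d x) = c0 x + M.d (c2 x) := fun x => rfl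
  have hc2a : ∀ x a, c2 (C.act x a) = M.act (c2 x) a + M.act (c1 x) (α.euler a) := fun x a => rfl
  let p : C ⟶ M :=
    { toLin := c1
      map_mem := fun n x hx => hx.2.1
      map_d := hc1d
      map_act := fun x a => rfl : Hom C M }
  let q : C ⟶ M.shift 1 :=
    { toLin := c0
      map_mem := fun n x hx => hx.1
      map_d := fun x => (hc0d x).trans (by
        change _ = (Int.negOnePow 1) • M.d (c0 x)
        simp)
      map_act := fun x a => rfl : Hom C (M.shift 1) }
  have hp : quasiIso A p := by
    rw [quasiIso_iff]
    constructor
    · rintro x hx ⟨y, hy⟩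
      refine ⟨coneMk ι (c2 x) (atiyahMk α M y 0), ?_⟩
      rw [hC]
      have h2 : c0 x + M.d (c2 x) = 0 := by rw [← hc2d, hx, map_zero]
      refine Prod.ext ?_ (Prod.ext hy ?_)
      · exact neg_eq_of_add_eq_zero_left h2
      · change c2 x + M.d 0 = c2 x
        rw [map_zero, add_zero]
    · intro y hy
      refine ⟨coneMk ι 0 (atiyahMk α M y 0), ?_, 0, ?_⟩
      · rw [hC, hy, map_zero, neg_zero, zero_add]
        rfl
      · rw [map_zero]
        exact (sub_self y).symm
  have hq : (quasiIso A).Q.map q = (quasiIso A).Q.map (zeroHom C (M.shift 1)) := by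
    have : IsIso ((quasiIso A).Q.map p) := Localization.inverts _ (quasiIso A) p hp
    rw [← cancel_epi (inv ((quasiIso A).Q.map p))]
    exact hM.elim _ _
  obtain ⟨X, t, ht, h, h1, h2, h3⟩ := exists_homotopic_of_Q_map_eq q _ hq
  let h' : X.carrier →ₗ[ℂ] M.carrier := (h :)
  have h3' : ∀ x, c0 (t.toLin x) = -M.d (h' x) + h' (X.d x) := fun x => by
    have h4 : (M.shift 1).d (h x) = -M.d (h' x) := by
      change (Int.negOnePow 1) • M.d (h' x) = _
      simp
    have h5 : q.toLin (t.toLin x) - 0 = (M.shift 1).d (h x) + h (X.d x) := h3 x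
    rw [h4, sub_zero] at h5
    exact h5
  refine ⟨X, t ≫ p, quasiIso_comp ht hp, ⟨c2 ∘ₗ t.toLin - h', fun n x hx => ?_, fun x => ?_,
    fun x a => ?_⟩⟩
  · refine Submodule.sub_mem _ (t.map_mem n x hx).2.2 ?_
    have : h' x ∈ M.deg (n - 1 + 1) := h1 n x hx
    rwa [sub_add_cancel] at this
  · simp only [LinearMap.sub_apply, LinearMap.comp_apply, t.map_d, hc2d, map_sub, h3']
    abel
  · have h2' : h' (X.act x a) = M.act (h' x) a := h2 x a
    simp only [LinearMap.sub_apply, LinearMap.comp_apply, t.map_act, hc2a, h2', map_sub]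
    change _ + M.act (c1 (t.toLin x)) _ - _ = _ + M.act (c1 (t.toLin x)) _
    abel

end DGModule

/-! ### Finitely supported functions with values in a graded space -/

/-- The degree `n` piece of the space of finitely supported functions `ι → V`. -/
def finsuppDeg {V : Type u} [AddCommGroup V] [Module ℂ V] (ι : Type) (p : ℤ → Submodule ℂ V)
    (n : ℤ) : Submodule ℂ (ι →₀ V) where
  carrier := {f | ∀ i, f i ∈ p n}
  add_mem' hf hg i := (p n).add_mem (hf i) (hg i)
  zero_mem' _ := (p n).zero_mem
  smul_mem' c _ hf i := (p n).smul_mem c (hf i)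

theorem single_mem_finsuppDeg {V : Type u} [AddCommGroup V] [Module ℂ V] {ι : Type}
    {p : ℤ → Submodule ℂ V} {n : ℤ} {v : V} (hv : v ∈ p n) (i : ι) :
    Finsupp.single i v ∈ finsuppDeg ι p n := fun j => by
  classical
  rw [Finsupp.single_apply]
  split_ifs
  exacts [hv, (p n).zero_mem]

theorem finsuppDeg_induction {V : Type u} [AddCommGroup V] [Module ℂ V] {ι : Type}
    {p : ℤ → Submodule ℂ V} {n : ℤ} {P : (ι →₀ V) → Prop} {f : ι →₀ V}
    (hf : f ∈ finsuppDeg ι p n) (zero : P 0) (add : ∀ f g, P f → P g → P (f + g))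
    (single : ∀ i, ∀ v ∈ p n, P (Finsupp.single i v)) : P f := by
  rw [← f.sum_single]
  exact Finset.sum_induction _ P add zero fun i _ => single i _ (hf i)

/-- A map to the direct sum of the graded pieces that is correct on functions supported at one point
is correct. -/
theorem eq_lof_of_single {V : Type u} [AddCommGroup V] [Module ℂ V] {ι : Type}
    {p : ℤ → Submodule ℂ V} {n : ℤ}
    (D : (ι →₀ V) →ₗ[ℂ] DirectSum ℤ fun k => finsuppDeg ι p k)
    (hD : ∀ i, ∀ v, ∀ hv : v ∈ p n, D (Finsupp.single i v) =
      DirectSum.lof ℂ ℤ (fun k => finsuppDeg ι p k) n ⟨_, single_mem_finsuppDeg hv i⟩)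
    (f : ι →₀ V) (hf : f ∈ finsuppDeg ι p n) :
    D f = DirectSum.lof ℂ ℤ (fun k => finsuppDeg ι p k) n ⟨f, hf⟩ := by
  refine (finsuppDeg_induction (P := fun f => ∃ hf : f ∈ finsuppDeg ι p n,
    D f = DirectSum.lof ℂ ℤ (fun k => finsuppDeg ι p k) n ⟨f, hf⟩) hf ?_ ?_ ?_).choose_spec
  · exact ⟨zero_mem _, (map_zero _).trans (map_zero _).symm⟩
  · rintro f g ⟨hf, hf'⟩ ⟨hg, hg'⟩
    refine ⟨add_mem hf hg, ?_⟩
    rw [map_add, hf', hg', ← map_add]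
    rfl
  · exact fun i v hv => ⟨single_mem_finsuppDeg hv i, hD i v hv⟩

/-- The grading of finitely supported functions by the degree of their values. -/
@[reducible]
noncomputable def finsuppDecomposition {V : Type u} [AddCommGroup V] [Module ℂ V] (ι : Type)
    (p : ℤ → Submodule ℂ V) [DirectSum.Decomposition p] :
    DirectSum.Decomposition (finsuppDeg ι p) :=
  DirectSum.Decomposition.ofLinearMap _
    (Finsupp.lsum ℂ fun i =>
      DirectSum.toModule ℂ ℤ _ (fun n =>
        DirectSum.lof ℂ ℤ (fun n => finsuppDeg ι p n) n ∘ₗ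
          (Finsupp.lsingle i).restrict (fun _ hv => single_mem_finsuppDeg hv i)) ∘ₗ
        (DirectSum.decomposeLinearEquiv p).toLinearMap)
    (by
      refine Finsupp.lhom_ext' fun i => LinearMap.ext fun v => ?_
      induction v using DirectSum.Decomposition.inductionOn p with
      | zero => simp
      | add a b ha hb => rw [map_add, map_add, ha, hb]
      | homogeneous v =>
        simp [DirectSum.decomposeLinearEquiv_apply, DirectSum.decompose_coe,
          DirectSum.toModule_lof, ← DirectSum.lof_eq_of ℂ]
        rfl)
    (by
      ext n ⟨f, hf⟩ : 2
      simp only [LinearMap.comp_apply, DirectSum.coeLinearMap_lof, LinearMap.id_apply]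
      refine eq_lof_of_single _ (fun i v hv => ?_) f hf
      refine (Finsupp.lsum_single ..).trans ?_
      rw [LinearMap.comp_apply, LinearEquiv.coe_coe,
        DirectSum.decomposeLinearEquiv_apply, DirectSum.decompose_of_mem p hv,
        ← DirectSum.lof_eq_of ℂ, DirectSum.toModule_lof]
      rfl)

namespace DGModule

variable {A : DGAlgebra.{u}}

/-! ### The torsion module -/

section

variable (α : A.RationalAction) (M : DGModule A)

/-- The right action of `A` on the functions supported at `i`: elements of weight `k` act on the
value and move the support from `(l, j)` to `(l + k, j)`. -/
noncomputable def torsionActSingle (i : ℂ × ℕ) :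
    M.carrier →ₗ[ℂ] A.carrier →ₗ[ℂ] (ℂ × ℕ →₀ M.carrier) :=
  LinearMap.mk₂ ℂ (fun m a => (α.rational.coaction a).sum fun k b =>
      Finsupp.single (i.1 + k, i.2) (M.act m b))
    (fun m m' a => by simp [Finsupp.sum_add])
    (fun c m a => by simp [Finsupp.smul_sum])
    (fun m a b => by
      rw [map_add, Finsupp.sum_add_index' (by simp) (by simp)])
    (fun c m a => by
      rw [map_smul, Finsupp.sum_smul_index' (by simp), Finsupp.smul_sum]
      simp)

/-- The right action of `A` on the torsion module of `M`, see `torsion`. -/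
noncomputable def torsionAct :
    (ℂ × ℕ →₀ M.carrier) →ₗ[ℂ] A.carrier →ₗ[ℂ] (ℂ × ℕ →₀ M.carrier) :=
  Finsupp.lsum ℂ (torsionActSingle α M)

variable {M}

theorem torsionAct_apply {k : ℤ} {a : A.carrier} (ha : a ∈ α.weight k)
    (f : ℂ × ℕ →₀ M.carrier) (i : ℂ × ℕ) :
    torsionAct α M f a i = M.act (f (i.1 - k, i.2)) a := by
  induction f using Finsupp.induction_linear with
  | zero => simp
  | add f g hf hg => simp [hf, hg]
  | single j m =>
    have : torsionAct α M (Finsupp.single j m) a = Finsupp.single (j.1 + k, j.2) (M.act m a) := by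
      rw [torsionAct, Finsupp.lsum_single, torsionActSingle, LinearMap.mk₂_apply,
        α.rational.coaction_of_mem ha, Finsupp.sum_single_index (by simp)]
    rw [this]
    by_cases h : (j.1 + k, j.2) = i
    · subst h
      simp
    · rw [Finsupp.single_eq_of_ne' h, Finsupp.single_eq_of_ne', LinearMap.map_zero₂]
      rintro rfl
      simp at h

theorem torsionAct_mem {i j : ℤ} {f : ℂ × ℕ →₀ M.carrier} {a : A.carrier}
    (hf : f ∈ finsuppDeg (ℂ × ℕ) M.deg i) (ha : a ∈ A.deg j) :
    torsionAct α M f a ∈ finsuppDeg (ℂ × ℕ) M.deg (i + j) := by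
  refine finsuppDeg_induction
    (P := fun f => torsionAct α M f a ∈ finsuppDeg (ℂ × ℕ) M.deg (i + j)) hf ?_ ?_ ?_
  · simp
  · intro f g hf hg
    rw [LinearMap.map_add₂]
    exact Submodule.add_mem _ hf hg
  · intro l m hm
    rw [torsionAct, Finsupp.lsum_single, torsionActSingle, LinearMap.mk₂_apply]
    refine Submodule.sum_mem _ fun k _ => single_mem_finsuppDeg (M.act_mem _ _ _ _ hm ?_) _
    exact α.rational.coaction_mem_of_stable (A.deg j) (fun z b hb => α.map_mem z j b hb) ha k

variable (M)

/-- The dg module `M ⊗ ℂ(t)/ℂ[t]`, where an element `a` of `A` of weight `k` acts by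
`(m ⊗ r(t)) a = m a ⊗ r(t - k)`. It is encoded by partial fractions: a function
`f : ℂ × ℕ →₀ M` stands for the sum of the `f (l, j) ⊗ (t - l)⁻¹⁻ʲ`. -/
noncomputable def torsion : DGModule A where
  carrier := ℂ × ℕ →₀ M.carrier
  deg := finsuppDeg (ℂ × ℕ) M.deg
  graded := finsuppDecomposition (ℂ × ℕ) M.deg
  d := Finsupp.mapRange.linearMap M.d
  d_mem := fun n f hf i => M.d_mem n _ (hf i)
  d_d := fun f => Finsupp.ext fun i => M.d_d _
  act := torsionAct α M
  act_mem := fun i j f a hf ha => torsionAct_mem α hf ha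
  act_one := fun f => Finsupp.ext fun i => by
    rw [torsionAct_apply α α.one_mem_weight, M.act_one, Int.cast_zero, sub_zero]
  act_mul := fun f a b => by
    induction a using α.rational.weight_induction with
    | zero => simp
    | add a a' ha ha' => simp only [map_add, add_mul, ha, ha', LinearMap.add_apply]
    | weight k a ha =>
      induction b using α.rational.weight_induction with
      | zero => simp
      | add b b' hb hb' => simp only [map_add, mul_add, hb, hb']
      | weight l b hb =>
        ext i
        rw [torsionAct_apply α (α.mul_mem_weight ha hb), torsionAct_apply α hb,
          torsionAct_apply α ha, M.act_mul, Int.cast_add, sub_sub, add_comm]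
  leibniz := fun n f a hf => by
    induction a using α.rational.weight_induction with
    | zero => simp
    | add a a' ha ha' => simp only [map_add, ha, ha', smul_add]; abel
    | weight k a ha =>
      ext i
      have := M.leibniz n (f (i.1 - k, i.2)) a (hf _)
      simp only [Finsupp.mapRange.linearMap_apply, Finsupp.mapRange_apply, Finsupp.add_apply,
        Finsupp.smul_apply, torsionAct_apply α ha, torsionAct_apply α (α.d_mem_weight ha), this]

end

/-! ### Equivariant structures -/

/-- The action of `ℂ^*` on the torsion module: the functions supported at `(l, j)` have weight
`⌊re l⌋`. The only property of `l ↦ ⌊re l⌋` that matters is compatibility with translations by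
integers. -/
noncomputable def torsionRep (V : Type u) [AddCommGroup V] [Module ℂ V] :
    Representation ℂ ℂˣ (ℂ × ℕ →₀ V) where
  toFun z := Finsupp.lsum ℂ fun i => ((z ^ ⌊i.1.re⌋ : ℂˣ) : ℂ) • Finsupp.lsingle i
  map_one' := Finsupp.lhom_ext' fun i => LinearMap.ext fun v => by simp
  map_mul' z w := Finsupp.lhom_ext' fun i => LinearMap.ext fun v => by
    simp [mul_zpow, smul_smul]

theorem torsionRep_single {V : Type u} [AddCommGroup V] [Module ℂ V] (z : ℂˣ) (i : ℂ × ℕ) (v : V) :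
    torsionRep V z (Finsupp.single i v) =
      ((z ^ ⌊i.1.re⌋ : ℂˣ) : ℂ) • Finsupp.single i v := by
  change Finsupp.lsum ℂ (fun i : ℂ × ℕ => ((z ^ ⌊i.1.re⌋ : ℂˣ) : ℂ) • Finsupp.lsingle i) _ = _
  rw [Finsupp.lsum_single]
  rfl

theorem torsionRep_apply {V : Type u} [AddCommGroup V] [Module ℂ V] (z : ℂˣ) (f : ℂ × ℕ →₀ V)
    (i : ℂ × ℕ) : torsionRep V z f i = ((z ^ ⌊i.1.re⌋ : ℂˣ) : ℂ) • f i := by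
  induction f using Finsupp.induction_linear with
  | zero => simp
  | add f g hf hg => rw [map_add, Finsupp.add_apply, hf, hg, Finsupp.add_apply, smul_add]
  | single j v =>
    rw [torsionRep_single, Finsupp.smul_apply]
    by_cases h : j = i
    · rw [h]
    · rw [Finsupp.single_eq_of_ne' h, smul_zero, smul_zero]

theorem isRationalRep_torsionRep (V : Type u) [AddCommGroup V] [Module ℂ V] :
    IsRationalRep (torsionRep V) := by
  intro f
  induction f using Finsupp.induction_linear with
  | zero => exact ⟨0, fun z => by simp⟩
  | add f g hf hg =>
    obtain ⟨c, hc⟩ := hf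
    obtain ⟨c', hc'⟩ := hg
    refine ⟨c + c', fun z => ?_⟩
    rw [map_add, hc, hc', Finsupp.sum_add_index' (by simp) (by simp)]
  | single i v =>
    refine ⟨Finsupp.single ⌊i.1.re⌋ (Finsupp.single i v), fun z => ?_⟩
    rw [torsionRep_single, Finsupp.sum_single_index (by simp)]

theorem torsionRep_act (α : A.RationalAction) (M : DGModule A) (z : ℂˣ) (f : ℂ × ℕ →₀ M.carrier)
    (a : A.carrier) : torsionRep M.carrier z (torsionAct α M f a) =
      torsionAct α M (torsionRep M.carrier z f) (α.ρ z a) := by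
  induction a using α.rational.weight_induction with
  | zero => simp
  | add a a' ha ha' => simp only [map_add, ha, ha']
  | weight k a ha =>
    ext i
    rw [ha z, map_smul, Finsupp.smul_apply, torsionRep_apply, torsionAct_apply α ha,
      torsionAct_apply α ha, torsionRep_apply, LinearMap.map_smul₂, smul_smul, ← Units.val_mul,
      ← zpow_add]
    simp

/-- The equivariant structure on the torsion module. -/
noncomputable def torsionEquivariant (α : A.RationalAction) (M : DGModule A) :
    EquivariantStructure α (torsion α M) where
  ρ := (torsionRep M.carrier :)
  rational := isRationalRep_torsionRep M.carrier
  map_mem := fun z n (f : ℂ × ℕ →₀ M.carrier) hf i =>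
    (torsionRep_apply z f i).symm ▸ Submodule.smul_mem _ _ (hf i)
  map_d := fun z (f : ℂ × ℕ →₀ M.carrier) => by
    refine Finsupp.ext fun i => ?_
    refine (torsionRep_apply z _ i).trans ?_
    change _ • M.d (f i) = M.d (torsionRep M.carrier z f i)
    rw [torsionRep_apply, map_smul]
  map_act := torsionRep_act α M

/-- The homotopy fibre of an equivariant morphism is equivariant. -/
noncomputable def fibEquivariant {α : A.RationalAction} {M N : DGModule A}
    (eM : EquivariantStructure α M) (eN : EquivariantStructure α N) (f : M ⟶ N)
    (hf : ∀ z m, f.toLin (eM.ρ z m) = eN.ρ z (f.toLin m)) : EquivariantStructure α (fib f) where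
  ρ := (eM.ρ.prod eN.ρ :)
  rational := fun x => by
    obtain ⟨c, hc⟩ := eM.rational x.1
    obtain ⟨c', hc'⟩ := eN.rational x.2
    have key : ∃ c : ℤ →₀ (M.carrier × N.carrier), ∀ z : ℂˣ, (eM.ρ.prod eN.ρ) z x =
        c.sum fun k w => ((z ^ k : ℂˣ) : ℂ) • w := by
      refine ⟨c.mapRange (LinearMap.inl ℂ _ _) (map_zero _) +
        c'.mapRange (LinearMap.inr ℂ _ _) (map_zero _), fun z => ?_⟩
      rw [Finsupp.sum_add_index' (by simp) (by simp), ← IsRationalRep.laurent_map,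
        ← IsRationalRep.laurent_map, ← hc, ← hc']
      simp only [LinearMap.inl_apply, LinearMap.inr_apply, Prod.mk_add_mk, add_zero, zero_add]
      rfl
    exact key
  map_mem := fun z n x h => by
    obtain ⟨m, n, rfl⟩ := fib_cases f x
    have := (fibMk_mem f).1 h
    exact (fibMk_mem f).2 ⟨eM.map_mem z _ _ this.1, eN.map_mem z _ _ this.2⟩
  map_d := fun z x => by
    obtain ⟨m, n, rfl⟩ := fib_cases f x
    have : ∀ m n, (eM.ρ.prod eN.ρ) z (fibMk f m n) = fibMk f (eM.ρ z m) (eN.ρ z n) :=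
      fun m n => rfl
    refine (congrArg _ (fib_d f m n)).trans ((this _ _).trans ?_)
    refine Eq.trans ?_ (congrArg _ (this _ _)).symm
    rw [fib_d]
    refine fibMk_inj.2 ?_
    simp [eM.map_d, eN.map_d, hf]
  map_act := fun z x a => Prod.ext (eM.map_act z x.1 a) (eN.map_act z x.2 a)

end DGModule

/-! ### Multiplication by the coordinate and residues on partial fractions -/

section PartialFractions

variable {V W : Type u} [AddCommGroup V] [Module ℂ V] [AddCommGroup W] [Module ℂ W]

variable (V) in
/-- Multiplication by `t` on `V ⊗ ℂ(t)/ℂ[t]`, in terms of partial fractions. -/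
noncomputable def mulCoord : (ℂ × ℕ →₀ V) →ₗ[ℂ] (ℂ × ℕ →₀ V) :=
  Finsupp.lsum ℂ fun i =>
    i.1 • Finsupp.lsingle i + match i.2 with
      | 0 => 0
      | j + 1 => Finsupp.lsingle (i.1, j)

theorem mulCoord_apply (f : ℂ × ℕ →₀ V) (l : ℂ) (j : ℕ) :
    mulCoord V f (l, j) = l • f (l, j) + f (l, j + 1) := by
  classical
  induction f using Finsupp.induction_linear with
  | zero => simp
  | add f g hf hg => rw [map_add, Finsupp.add_apply, hf, hg]; simp; abel
  | single i v =>
    obtain ⟨m, k⟩ := i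
    rw [mulCoord, Finsupp.lsum_single]
    rcases k with _ | k
    · by_cases h : (m, 0) = (l, j)
      · obtain ⟨rfl, rfl⟩ := Prod.mk_inj.1 h
        simp
      · simp [Finsupp.single_eq_of_ne' h]
    · simp only [LinearMap.add_apply, LinearMap.smul_apply, Finsupp.lsingle_apply,
        Finsupp.add_apply, Finsupp.smul_apply, Finsupp.single_apply, Prod.mk_inj,
        Nat.add_right_cancel_iff]
      congr 1
      by_cases h : m = l ∧ k + 1 = j
      · simp [h]
      · simp [h]

variable (V) in
/-- The sum of the residues, on `V ⊗ ℂ(t)/ℂ[t]`. -/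
noncomputable def residue : (ℂ × ℕ →₀ V) →ₗ[ℂ] V :=
  Finsupp.lsum ℂ fun i => if i.2 = 0 then LinearMap.id else 0

theorem residue_single (i : ℂ × ℕ) (v : V) :
    residue V (Finsupp.single i v) = if i.2 = 0 then v else 0 := by
  rw [residue, Finsupp.lsum_single]
  split_ifs <;> rfl

theorem residue_mapRange (φ : V →ₗ[ℂ] W) (f : ℂ × ℕ →₀ V) :
    residue W (Finsupp.mapRange.linearMap φ f) = φ (residue V f) := by
  induction f using Finsupp.induction_linear with
  | zero => simp
  | add f g hf hg => simp only [map_add, hf, hg]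
  | single i v =>
    rw [Finsupp.mapRange.linearMap_apply, Finsupp.mapRange_single, residue_single, residue_single]
    split_ifs <;> simp

theorem residue_eq_sum (f : ℂ × ℕ →₀ V) :
    residue V f = ∑ l ∈ f.support.image Prod.fst, f (l, 0) := by
  let T := insert 0 (f.support.image Prod.snd)
  have hT : f.support ⊆ f.support.image Prod.fst ×ˢ T := fun i hi =>
    Finset.mem_product.2 ⟨Finset.mem_image_of_mem _ hi,
      Finset.mem_insert_of_mem (Finset.mem_image_of_mem _ hi)⟩
  rw [residue, Finsupp.lsum_apply, Finsupp.sum_of_support_subset f hT _ (by simp),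
    Finset.sum_product]
  refine Finset.sum_congr rfl fun l _ => ?_
  rw [Finset.sum_eq_single_of_mem 0 (Finset.mem_insert_self _ _) fun j _ hj => by simp [hj]]
  simp

/-- The operator `δ - s t` on partial fractions. -/
noncomputable def connectionSub (s δ : V →ₗ[ℂ] W) : (ℂ × ℕ →₀ V) →ₗ[ℂ] (ℂ × ℕ →₀ W) :=
  Finsupp.mapRange.linearMap δ - Finsupp.mapRange.linearMap s ∘ₗ mulCoord V

theorem connectionSub_apply (s δ : V →ₗ[ℂ] W) (f : ℂ × ℕ →₀ V) (l : ℂ) (j : ℕ) :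
    connectionSub s δ f (l, j) = δ (f (l, j)) - s (l • f (l, j) + f (l, j + 1)) := by
  rw [← mulCoord_apply]
  rfl

variable (E : Module.End ℂ V)

theorem connectionSub_single_zero (l : ℂ) (v : V) :
    connectionSub LinearMap.id E (Finsupp.single (l, 0) v) =
      Finsupp.single (l, 0) ((E - l • 1) v) := by
  simp [connectionSub, mulCoord, Finsupp.single_sub]

theorem connectionSub_single_succ (l : ℂ) (j : ℕ) (v : V) :
    connectionSub LinearMap.id E (Finsupp.single (l, j + 1) v) =
      Finsupp.single (l, j + 1) ((E - l • 1) v) - Finsupp.single (l, j) v := by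
  simp [connectionSub, mulCoord, Finsupp.single_sub, sub_sub]

/-- The truncation `∑_{j ≤ r} (E - l)^j v (t - l)⁻¹⁻ʲ` of the partial fraction expansion of
`(t - E)⁻¹ v`. -/
noncomputable def resolventSum (l : ℂ) (v : V) (r : ℕ) : ℂ × ℕ →₀ V :=
  ∑ j ∈ Finset.range (r + 1), Finsupp.single (l, j) (((E - l • 1) ^ j) v)

theorem connectionSub_resolventSum (l : ℂ) (v : V) (r : ℕ) :
    connectionSub LinearMap.id E (resolventSum E l v r) =
      Finsupp.single (l, r) (((E - l • 1) ^ (r + 1)) v) := by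
  induction r with
  | zero => simp [resolventSum, connectionSub_single_zero]
  | succ r ih =>
    rw [resolventSum, Finset.sum_range_succ, map_add, ← resolventSum, ih,
      connectionSub_single_succ, add_sub_cancel, ← Module.End.mul_apply, ← pow_succ']

theorem residue_resolventSum (l : ℂ) (v : V) (r : ℕ) : residue V (resolventSum E l v r) = v := by
  rw [resolventSum, map_sum, Finset.sum_range_succ']
  simp [residue_single]

/-- The residue is injective on the kernel of `E - t`. -/
theorem eq_zero_of_residue_eq_zero {f : ℂ × ℕ →₀ V} (hf : connectionSub LinearMap.id E f = 0)
    (hr : residue V f = 0) : f = 0 := by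
  have h0 : ∀ l j, f (l, j) = ((E - l • 1) ^ j) (f (l, 0)) := by
    intro l j
    induction j with
    | zero => simp
    | succ j ih =>
      have := DFunLike.congr_fun hf (l, j)
      rw [connectionSub_apply, Finsupp.zero_apply, sub_eq_zero, LinearMap.id_apply] at this
      rw [pow_succ', Module.End.mul_apply, ← ih, LinearMap.sub_apply, this]
      simp
  have hmem : ∀ l, f (l, 0) ∈ E.maxGenEigenspace l := by
    intro l
    obtain ⟨j, hj⟩ := Infinite.exists_notMem_finset (f.support.image Prod.snd)
    refine (E.mem_maxGenEigenspace l _).2 ⟨j, ?_⟩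
    rw [← h0]
    by_contra h
    exact hj (Finset.mem_image.2 ⟨(l, j), Finsupp.mem_support_iff.2 h, rfl⟩)
  have h1 : ∀ l, f (l, 0) = 0 := by
    intro l
    rw [residue_eq_sum] at hr
    by_contra h
    exact h ((iSupIndep_iff_finsetSum_eq_zero_imp_eq_zero _).1 E.independent_maxGenEigenspace
      (f.support.image Prod.fst) (fun l => f (l, 0)) (fun l _ => hmem l) hr l
      (Finset.mem_image.2 ⟨(l, 0), Finsupp.mem_support_iff.2 h, rfl⟩))
  ext ⟨l, j⟩
  rw [h0, h1, map_zero, Finsupp.zero_apply]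

variable [FiniteDimensional ℂ V]

/-- On a finite-dimensional space, `E - t` is onto. -/
theorem connectionSub_surjective : Function.Surjective (connectionSub LinearMap.id E) := by
  intro g
  induction g using Finsupp.induction_linear with
  | zero => exact ⟨0, map_zero _⟩
  | add g g' hg hg' =>
    obtain ⟨f, rfl⟩ := hg
    obtain ⟨f', rfl⟩ := hg'
    exact ⟨f + f', map_add _ _ _⟩
  | single i v =>
    obtain ⟨l, j⟩ := i
    obtain ⟨n, hn, hjn⟩ := ((E - l • 1).eventually_codisjoint_ker_pow_range_pow.and
      (Filter.eventually_ge_atTop (j + 1))).exists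
    have hv : v ∈ LinearMap.ker ((E - l • 1) ^ n) ⊔ LinearMap.range ((E - l • 1) ^ n) := by
      rw [hn.eq_top]
      trivial
    obtain ⟨a, ha, _, ⟨w, rfl⟩, rfl⟩ := Submodule.mem_sup.1 hv
    have key : ∀ m, connectionSub LinearMap.id E
        (∑ i ∈ Finset.range m, Finsupp.single (l, j + i + 1) (((E - l • 1) ^ i) a)) =
          Finsupp.single (l, j + m) (((E - l • 1) ^ m) a) - Finsupp.single (l, j) a := by
      intro m
      induction m with
      | zero => simp
      | succ m ih =>
        rw [Finset.sum_range_succ, map_add, ih, connectionSub_single_succ,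
          ← Module.End.mul_apply, ← pow_succ', add_assoc j m 1]
        abel
    refine ⟨resolventSum E l (((E - l • 1) ^ (n - (j + 1))) w) j -
      ∑ i ∈ Finset.range n, Finsupp.single (l, j + i + 1) (((E - l • 1) ^ i) a), ?_⟩
    rw [map_sub, connectionSub_resolventSum, key, LinearMap.mem_ker.1 ha, Finsupp.single_zero,
      ← Module.End.mul_apply, ← pow_add, Nat.add_sub_cancel' hjn, Finsupp.single_add]
    abel

/-- The residue maps the kernel of `E - t` onto `V`. -/
theorem exists_residue_eq (v : V) :
    ∃ f : ℂ × ℕ →₀ V, connectionSub LinearMap.id E f = 0 ∧ residue V f = v := by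
  have hv : v ∈ ⨆ l, E.maxGenEigenspace l := by
    rw [E.iSup_maxGenEigenspace_eq_top]
    trivial
  induction hv using Submodule.iSup_induction' with
  | zero => exact ⟨0, map_zero _, map_zero _⟩
  | add v w _ _ hv hw =>
    obtain ⟨f, hf, rfl⟩ := hv
    obtain ⟨g, hg, rfl⟩ := hw
    exact ⟨f + g, by rw [map_add, hf, hg, add_zero], map_add _ _ _⟩
  | mem l v hv =>
    obtain ⟨r, hr⟩ := (E.mem_maxGenEigenspace l v).1 hv
    refine ⟨resolventSum E l v r, ?_, residue_resolventSum E l v r⟩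
    rw [connectionSub_resolventSum, pow_succ', Module.End.mul_apply, hr, map_zero,
      Finsupp.single_zero]

end PartialFractions

/-! ### Splittings of a complex of vector spaces -/

/-- A linear choice of primitives of the coboundaries. -/
theorem exists_primitive {V : Type u} [AddCommGroup V] [Module ℂ V] (d : V →ₗ[ℂ] V) :
    ∃ b : V →ₗ[ℂ] V, ∀ w, d (b (d w)) = d w := by
  obtain ⟨g, hg⟩ := d.rangeRestrict.exists_rightInverse_of_surjective d.range_rangeRestrict
  obtain ⟨b, hb⟩ := LinearMap.exists_extend g
  refine ⟨b, fun w => ?_⟩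
  have h1 : b (d w) = g (d.rangeRestrict w) := LinearMap.congr_fun hb (d.rangeRestrict w)
  have h2 := congrArg Subtype.val (LinearMap.congr_fun hg (d.rangeRestrict w))
  rw [h1]
  exact h2

/-- A linear choice of cocycles that represent the cohomology classes. -/
theorem exists_cohomology_section {V : Type u} [AddCommGroup V] [Module ℂ V] (d : V →ₗ[ℂ] V) :
    ∃ σ : Cohomology d →ₗ[ℂ] V, ∀ c, ∃ h : d (σ c) = 0,
      Submodule.Quotient.mk ⟨σ c, h⟩ = c := by
  let q := ((LinearMap.range d).submoduleOf (LinearMap.ker d)).mkQ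
  obtain ⟨g, hg⟩ := q.exists_rightInverse_of_surjective (Submodule.range_mkQ _)
  exact ⟨(LinearMap.ker d).subtype ∘ₗ g, fun c => ⟨(g c).2, LinearMap.congr_fun hg c⟩⟩

/-- A linear extension, to all cochains, of the map from cocycles to cohomology classes. Unlike the
classes themselves, it can be applied to the values of a finitely supported function. -/
theorem exists_cohomology_class {V : Type u} [AddCommGroup V] [Module ℂ V] (d : V →ₗ[ℂ] V) :
    ∃ π : V →ₗ[ℂ] Cohomology d, ∀ x, ∀ h : d x = 0, π x = Submodule.Quotient.mk ⟨x, h⟩ := by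
  obtain ⟨π, hπ⟩ := LinearMap.exists_extend
    ((LinearMap.range d).submoduleOf (LinearMap.ker d)).mkQ
  exact ⟨π, fun x h => LinearMap.congr_fun hπ ⟨x, h⟩⟩

namespace DGModule

variable {A : DGAlgebra.{u}}

/-! ### The equivariant resolution given by a connection -/

section

variable {α : A.RationalAction} {X M : DGModule A} {s : X ⟶ M} (δ : Connection α s)

theorem Connection.sub_d (f : ℂ × ℕ →₀ X.carrier) :
    connectionSub s.toLin δ.toLin (Finsupp.mapRange.linearMap X.d f) =
      Finsupp.mapRange.linearMap M.d (connectionSub s.toLin δ.toLin f) := by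
  ext ⟨l, j⟩
  simp only [connectionSub_apply, Finsupp.mapRange.linearMap_apply, Finsupp.mapRange_apply,
    ← map_smul, ← map_add, s.map_d, δ.map_d, ← map_sub]

theorem Connection.sub_act (f : ℂ × ℕ →₀ X.carrier) (a : A.carrier) :
    connectionSub s.toLin δ.toLin (torsionAct α X f a) =
      torsionAct α M (connectionSub s.toLin δ.toLin f) a := by
  induction a using α.rational.weight_induction with
  | zero => simp
  | add a a' ha ha' => simp only [map_add, ha, ha']
  | weight k a ha =>
    ext ⟨l, j⟩
    rw [connectionSub_apply, torsionAct_apply α ha, torsionAct_apply α ha, torsionAct_apply α ha,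
      connectionSub_apply, δ.map_act, α.euler_of_mem ha]
    simp only [map_add, map_smul, map_sub, s.map_act, LinearMap.sub_apply, LinearMap.add_apply,
      LinearMap.smul_apply, sub_smul]
    abel

theorem Connection.sub_rep (z : ℂˣ) (f : ℂ × ℕ →₀ X.carrier) :
    connectionSub s.toLin δ.toLin (torsionRep X.carrier z f) =
      torsionRep M.carrier z (connectionSub s.toLin δ.toLin f) := by
  ext ⟨l, j⟩
  simp only [connectionSub_apply, torsionRep_apply, map_add, map_smul, smul_sub, smul_add,
    smul_comm l]

theorem Connection.sub_mem {n : ℤ} {f : ℂ × ℕ →₀ X.carrier} (hf : f ∈ finsuppDeg (ℂ × ℕ) X.deg n) :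
    connectionSub s.toLin δ.toLin f ∈ finsuppDeg (ℂ × ℕ) M.deg n := fun i => by
  rw [connectionSub_apply s.toLin δ.toLin f i.1 i.2]
  exact Submodule.sub_mem _ (δ.map_mem n _ (hf i)) (s.map_mem n _
    (Submodule.add_mem _ (Submodule.smul_mem _ _ (hf _)) (hf _)))

/-- The morphism `δ - s t` between torsion modules given by a connection `δ` along `s`. -/
noncomputable def Connection.subHom : torsion α X ⟶ torsion α M :=
  { toLin := (connectionSub s.toLin δ.toLin :)
    map_mem := fun _ _ hf => δ.sub_mem hf
    map_d := δ.sub_d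
    map_act := δ.sub_act : Hom (torsion α X) (torsion α M) }

variable (α) in
theorem residue_act (X : DGModule A) (f : ℂ × ℕ →₀ X.carrier) (a : A.carrier) :
    residue X.carrier (torsionAct α X f a) = X.act (residue X.carrier f) a := by
  induction f using Finsupp.induction_linear with
  | zero => simp
  | add f g hf hg => simp only [map_add, LinearMap.add_apply, hf, hg]
  | single i m =>
    rw [torsionAct, Finsupp.lsum_single, torsionActSingle, LinearMap.mk₂_apply, Finsupp.sum,
      map_sum]
    simp only [residue_single]
    split_ifs
    · rw [← map_sum]
      exact congrArg _ (α.rational.sum_coaction a)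
    · simp

theorem residue_mem (X : DGModule A) {n : ℤ} {f : ℂ × ℕ →₀ X.carrier}
    (hf : f ∈ finsuppDeg (ℂ × ℕ) X.deg n) : residue X.carrier f ∈ X.deg n := by
  rw [residue_eq_sum]
  exact Submodule.sum_mem _ fun l _ => hf _

variable (α) in
/-- The residue, as a morphism of dg modules. -/
noncomputable def residueHom (X : DGModule A) : torsion α X ⟶ X :=
  { toLin := (residue X.carrier :)
    map_mem := fun _ _ hf => residue_mem X hf
    map_d := residue_mapRange X.d
    map_act := residue_act α X : Hom (torsion α X) X }

/-- If `s` is a quasi-isomorphism and the cohomology is finite-dimensional, the residue is a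
quasi-isomorphism from the homotopy fibre of `δ - s t`: on cohomology, `δ - s t` becomes `E - t` for
an endomorphism `E` of a finite-dimensional space, which is onto and has kernel mapped isomorphically
to that space by the residue. -/
theorem quasiIso_residue (hs : quasiIso A s) (hX : FiniteDimensional ℂ (Cohomology X.d)) :
    quasiIso A (fibFst δ.subHom ≫ residueHom α X) := by
  obtain ⟨bX, hbX⟩ := exists_primitive X.d
  obtain ⟨bM, hbM⟩ := exists_primitive M.d
  obtain ⟨σ, hσ⟩ := exists_cohomology_section X.d
  obtain ⟨πX, hπX⟩ := exists_cohomology_class X.d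
  obtain ⟨πM, hπM⟩ := exists_cohomology_class M.d
  let e := LinearEquiv.ofBijective (cohomologyMap s) hs
  let D : Cohomology X.d →ₗ[ℂ] Cohomology M.d := cohomologyLift δ.toLin
    (fun x hx => by rw [← δ.map_d, hx, map_zero]) (fun x => ⟨δ.toLin x, (δ.map_d x).symm⟩)
  let E : Module.End ℂ (Cohomology X.d) := e.symm.toLinearMap ∘ₗ D
  let Θ := connectionSub s.toLin δ.toLin
  have dΘ : ∀ f : ℂ × ℕ →₀ X.carrier, (∀ i, X.d (f i) = 0) → ∀ i, M.d (Θ f i) = 0 := by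
    intro f hf i
    refine (DFunLike.congr_fun (δ.sub_d f) i).symm.trans ?_
    rw [show Finsupp.mapRange.linearMap X.d f = 0 from Finsupp.ext hf, map_zero]
    rfl
  have es : ∀ x, X.d x = 0 → e (πX x) = πM (s.toLin x) := by
    intro x hx
    rw [hπX x hx, hπM _ (by rw [← s.map_d, hx, map_zero])]
    rfl
  have eE : ∀ x, X.d x = 0 → e (E (πX x)) = πM (δ.toLin x) := by
    intro x hx
    refine (e.apply_symm_apply _).trans ?_
    rw [hπX x hx, hπM _ (by rw [← δ.map_d, hx, map_zero])]
    rfl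
  -- the class of `(δ - s t) f` is the value of `E - t` at the class of `f`
  have hE : ∀ f : ℂ × ℕ →₀ X.carrier, (∀ i, X.d (f i) = 0) → ∀ i,
      e (connectionSub LinearMap.id E (Finsupp.mapRange.linearMap πX f) i) = πM (Θ f i) := by
    rintro f hf ⟨l, j⟩
    simp only [Θ, connectionSub_apply, Finsupp.mapRange.linearMap_apply, Finsupp.mapRange_apply,
      LinearMap.id_apply, map_sub, map_add, map_smul, eE _ (hf _), es _ (hf _)]
  have hσπ : ∀ f : ℂ × ℕ →₀ Cohomology X.d,
      Finsupp.mapRange.linearMap πX (Finsupp.mapRange.linearMap σ f) = f := fun f =>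
    Finsupp.ext fun i => by
      obtain ⟨h, hc⟩ := hσ (f i)
      exact (hπX _ h).trans hc
  have exX : ∀ x, X.d x = 0 → πX x = 0 → X.d (bX x) = x := by
    intro x hx h
    rw [hπX x hx] at h
    obtain ⟨w, hw⟩ := (cohomology_mk_eq_zero _).1 h
    replace hw : X.d w = x := hw
    rw [← hw, hbX]
  have exM : ∀ x, M.d x = 0 → πM x = 0 → M.d (bM x) = x := by
    intro x hx h
    rw [hπM x hx] at h
    obtain ⟨w, hw⟩ := (cohomology_mk_eq_zero _).1 h
    replace hw : M.d w = x := hw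
    rw [← hw, hbM]
  have πd : ∀ w, πM (M.d w) = 0 := fun w => by
    rw [hπM _ (M.d_d w)]
    exact (cohomology_mk_eq_zero _).2 ⟨w, rfl⟩
  rw [quasiIso_iff]
  constructor
  · rintro x hx ⟨y, hy⟩
    obtain ⟨f, g, rfl⟩ := fib_cases _ x
    rw [fib_d, fibMk_eq_zero] at hx
    obtain ⟨h1, h2⟩ := hx
    let f : ℂ × ℕ →₀ X.carrier := f
    let g : ℂ × ℕ →₀ M.carrier := g
    replace h1 : ∀ i, X.d (f i) = 0 := fun i => DFunLike.congr_fun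
      (show Finsupp.mapRange.linearMap X.d f = 0 from h1) i
    replace h2 : ∀ i, Θ f i + M.d (g i) = 0 := fun i => DFunLike.congr_fun
      (show Θ f + Finsupp.mapRange.linearMap M.d g = 0 from neg_eq_zero.1 h2) i
    replace hy : X.d y = residue X.carrier f := hy
    have hf0 : Finsupp.mapRange.linearMap πX f = 0 := by
      refine eq_zero_of_residue_eq_zero E ?_ ?_
      · ext i
        refine e.injective ?_
        rw [hE f h1, eq_neg_of_add_eq_zero_left (h2 i), map_neg, πd]
        simp
      · rw [residue_mapRange, ← hy, hπX _ (X.d_d y)]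
        exact (cohomology_mk_eq_zero _).2 ⟨y, rfl⟩
    -- `f` is a coboundary `d f1`; it remains to correct the cocycle `g1` by a term `(δ - s t) f2`,
    -- which is possible since `E - t` is onto
    let f1 : ℂ × ℕ →₀ X.carrier := Finsupp.mapRange.linearMap bX f
    have hf1 : ∀ i, X.d (f1 i) = f i := fun i => exX _ (h1 i) (DFunLike.congr_fun hf0 i)
    let g1 : ℂ × ℕ →₀ M.carrier := Θ f1 + g
    have hg1 : ∀ i, M.d (g1 i) = 0 := by
      intro i
      have : Θ f i = M.d (Θ f1 i) := by
        have h := DFunLike.congr_fun (δ.sub_d f1) i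
        rw [show Finsupp.mapRange.linearMap X.d f1 = f from Finsupp.ext hf1] at h
        exact h
      rw [Finsupp.add_apply, map_add, ← this, h2]
    obtain ⟨c, hc⟩ := connectionSub_surjective E
      (Finsupp.mapRange.linearMap (e.symm.toLinearMap ∘ₗ πM) g1)
    let f2 : ℂ × ℕ →₀ X.carrier := Finsupp.mapRange.linearMap σ c
    have hf2 : ∀ i, X.d (f2 i) = 0 := fun i => (hσ (c i)).1
    have hg2 : ∀ i, πM (g1 i - Θ f2 i) = 0 := by
      intro i
      rw [map_sub, ← hE f2 hf2, hσπ, hc, sub_eq_zero]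
      exact (e.apply_symm_apply _).symm
    let g2 : ℂ × ℕ →₀ M.carrier := -Finsupp.mapRange.linearMap bM (g1 - Θ f2)
    have hg2' : ∀ i, M.d (g2 i) = -(g1 i - Θ f2 i) := by
      intro i
      refine (map_neg M.d _).trans (congrArg _ ?_)
      exact exM _ (by rw [Finsupp.sub_apply, map_sub, hg1, dΘ f2 hf2, sub_zero]) (hg2 i)
    refine ⟨fibMk δ.subHom (f1 - f2 : ℂ × ℕ →₀ X.carrier) g2, ?_⟩
    refine (fib_d _ _ _).trans (fibMk_inj.2 ⟨Finsupp.ext fun i => ?_, Finsupp.ext fun i => ?_⟩)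
    · change X.d (f1 i - f2 i) = f i
      rw [map_sub, hf1, hf2, sub_zero]
    · change -(Θ (f1 - f2) i + M.d (g2 i)) = g i
      rw [hg2', map_sub]
      simp only [g1, Finsupp.add_apply, Finsupp.sub_apply]
      abel
  · intro y hy
    obtain ⟨c, hc, hr⟩ := exists_residue_eq E (πX y)
    let f : ℂ × ℕ →₀ X.carrier := Finsupp.mapRange.linearMap σ c
    have hf : ∀ i, X.d (f i) = 0 := fun i => (hσ (c i)).1
    let g : ℂ × ℕ →₀ M.carrier := -Finsupp.mapRange.linearMap bM (Θ f)
    have hg : ∀ i, M.d (g i) = -Θ f i := by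
      intro i
      refine (map_neg M.d _).trans (congrArg _ ?_)
      refine exM _ (dΘ f hf i) ?_
      rw [← hE f hf, hσπ, hc, Finsupp.zero_apply, map_zero]
    refine ⟨fibMk δ.subHom f g, ?_, bX (y - residue X.carrier f), ?_⟩
    · refine (fib_d _ _ _).trans (fibMk_eq_zero.2 ⟨Finsupp.ext hf, Finsupp.ext fun i => ?_⟩)
      change -(Θ f i + M.d (g i)) = 0
      rw [hg, add_neg_cancel, neg_zero]
    · have hres : residue X.carrier f = σ (πX y) := by rw [← hr, ← residue_mapRange]
      obtain ⟨h1, h2⟩ := hσ (πX y)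
      refine exX _ ?_ ?_
      · rw [hres, map_sub, hy, h1, sub_zero]
      · rw [hres, map_sub, sub_eq_zero, hπX _ h1, h2]

end

end DGModule

theorem theorem1p8 (A : DGAlgebra.{u}) (hA : A.IsProper) (α : A.RationalAction)
    (M : DGModule A) (hperf : M.IsPerfect) (hrigid : M.IsRigid) (hsimple : M.IsSimple) :
    ∃ N : DGModule A, Nonempty (DGModule.EquivariantStructure α N) ∧ M.QuasiIsomorphic N := by
  obtain ⟨X, s, hs, ⟨δ⟩⟩ := DGModule.exists_connection α M hrigid
  have hM := DGModule.finiteDimensional_cohomology_of_isPerfect hA hperf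
  have hX : FiniteDimensional ℂ (Cohomology X.d) :=
    FiniteDimensional.of_injective (DGModule.cohomologyMap s) hs.1
  refine ⟨DGModule.fib δ.subHom, ⟨DGModule.fibEquivariant (DGModule.torsionEquivariant α X)
    (DGModule.torsionEquivariant α M) δ.subHom δ.sub_rep⟩, ?_⟩
  exact .trans _ _ _ (.symm _ _ (.rel _ _ ⟨s, hs⟩))
    (.symm _ _ (.rel _ _ ⟨_, DGModule.quasiIso_residue δ hs hX⟩))
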